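/- Let $k$ and $t$ be natural numbers with $k\ge 3$ and $t\ge\lfloor k/2\rfloor$, and write $e(z)=e^{2\pi i z}$. Let $\kappa=\kappa_k$ be the multiplicative function on the positive integers defined on powers of a prime $p$ by \[ \kappa(p^{uk+v})=\begin{cases}kp^{-u-1/2},&\text{when }u\ge 0\text{ and }v=1,\\ p^{-u-1},&\text{when }u\ge 0\text{ and }2\le v\le k.\end{cases} \] Let $\delta,Q,X,Y$ be real numbers with \[ \delta>1,\quad Q\ge 1,\quad X\ge 1,\quad Y>0,\quad QY\le \tfrac14X^k . \] For integers $a,q$ with $0\le a\le q\le Q$ and $(a,q)=1$ put \[ \mathcal M(q,a)=\{\alpha\in[0,1): |q\alpha-a|\le YX^{-k}\}. \] These sets are pairwise disjoint. Let $\mathcal M=\mathcal M_{Q,X,Y}$ be their union, and define $\Upsilon:\mathcal M\to[0,\infty)$ by \[ \Upsilon(\alpha)=\kappa(q)^2\bigl(1+X^k|\alpha-a/q|\bigr)^{-\delta}\qquad\text{when }\alpha\in\mathcal M(q,a). \] Then, for each $\varepsilon>0$ and every set $\mathcal Z\subseteq[1,X]\cap\mathbb Z$, one has \[ \int_{\mathcal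 M}\Upsilon(\alpha)\Bigl|\sum_{x\in\mathcal Z}e(\alpha x^k)\Bigr|^{2t}\,d\alpha\ll Q^{\varepsilon}X^{2t-k}+X^{-k}Q^{t+1+\varepsilon}, \] where the implicit constant depends at most on $k$, $t$, $\delta$ and $\varepsilon$ (and not on $Q$, $X$, $Y$ or $\mathcal Z$). -/

import Mathlib

noncomputable section

namespace Pruning

/-- The value at `p ^ l` (with `l ≥ 1`) of the multiplicative function `κ = κ_k`. Writing
`l = u * k + v` with `1 ≤ v ≤ k`, one has `u = (l - 1) / k` and `v = (l - 1) % k + 1`; the value is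
`k * p ^ (-u - 1/2)` when `v = 1` and `p ^ (-u - 1)` when `2 ≤ v ≤ k`. -/
def kappaPrimePow (k p l : ℕ) : ℝ :=
  if (l - 1) % k = 0 then (k : ℝ) * (p : ℝ) ^ (-(((l - 1) / k : ℕ) : ℝ) - 1 / 2)
  else (p : ℝ) ^ (-(((l - 1) / k : ℕ) : ℝ) - 1)

/-- The multiplicative function `κ(q) = κ_k(q)`: the product of `kappaPrimePow k p l` over the prime
powers `p ^ l` that exactly divide `q`. -/
def kappa (k q : ℕ) : ℝ := q.factorization.prod (kappaPrimePow k)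

theorem kappa_one (k : ℕ) : kappa k 1 = 1 := by simp [kappa]

theorem kappa_mul {k m n : ℕ} (h : m.Coprime n) : kappa k (m * n) = kappa k m * kappa k n := by
  unfold kappa
  rw [Nat.factorization_mul_of_coprime h]
  exact Finsupp.prod_add_index_of_disjoint (Nat.Coprime.disjoint_primeFactors h) _

theorem kappa_prime_pow {k p u v : ℕ} (hp : p.Prime) (hv : 1 ≤ v) (hvk : v ≤ k) :
    kappa k (p ^ (u * k + v)) =
      if v = 1 then (k : ℝ) * (p : ℝ) ^ (-(u : ℝ) - 1 / 2) else (p : ℝ) ^ (-(u : ℝ) - 1) := by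
  obtain ⟨w, rfl⟩ : ∃ w, v = w + 1 := ⟨v - 1, by omega⟩
  have hk : 0 < k := by omega
  have hl : (u * k + (w + 1) : ℕ) ≠ 0 := by omega
  have h1 : u * k + (w + 1) - 1 = w + k * u := by rw [mul_comm u k]; omega
  have hw : w < k := by omega
  unfold kappa
  rw [Nat.Prime.factorization_pow hp, Finsupp.prod, Finsupp.support_single _ hl]
  simp only [Finset.prod_singleton, Finsupp.single_eq_same, kappaPrimePow, h1,
    Nat.add_mul_mod_self_left, Nat.add_mul_div_left _ _ hk, Nat.mod_eq_of_lt hw,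
    Nat.div_eq_of_lt hw, zero_add]
  simp

/-- The interval `𝓜(q, a) = {α ∈ [0, 1) : |q α - a| ≤ Y X ^ (-k)}`. -/
def arc (k : ℕ) (X Y : ℝ) (q a : ℕ) : Set ℝ :=
  {α | α ∈ Set.Ico (0 : ℝ) 1 ∧ |(q : ℝ) * α - a| ≤ Y / X ^ k}

/-- The pairs `(q, a)` with `0 ≤ a ≤ q ≤ Q` and `(a, q) = 1` (so that `q ≥ 1`). -/
def arcIndex (Q : ℝ) : Finset (ℕ × ℕ) :=
  (Finset.range (⌊Q⌋₊ + 1) ×ˢ Finset.range (⌊Q⌋₊ + 1)).filter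
    (fun c => c.2 ≤ c.1 ∧ c.2.Coprime c.1)

theorem mem_arcIndex {Q : ℝ} (hQ : 0 ≤ Q) {q a : ℕ} :
    (q, a) ∈ arcIndex Q ↔ a ≤ q ∧ (q : ℝ) ≤ Q ∧ a.Coprime q := by
  simp only [arcIndex, Finset.mem_filter, Finset.mem_product, Finset.mem_range, Nat.lt_succ_iff,
    ← Nat.le_floor_iff hQ]
  constructor
  · rintro ⟨⟨h1, -⟩, h2, h3⟩
    exact ⟨h2, h1, h3⟩
  · rintro ⟨h2, h1, h3⟩
    exact ⟨⟨h1, h2.trans h1⟩, h2, h3⟩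

/-- The set of major arcs `𝓜 = 𝓜_{Q,X,Y}`, the union of the intervals `𝓜(q, a)` over
`0 ≤ a ≤ q ≤ Q` with `(a, q) = 1`. -/
def majorArcs (k : ℕ) (Q X Y : ℝ) : Set ℝ := ⋃ c ∈ arcIndex Q, arc k X Y c.1 c.2

/-- The weight `Υ`, equal to `κ(q)² (1 + X ^ k |α - a / q|) ^ (-δ)` when `α ∈ 𝓜(q, a)`. It is
written as a sum over all arcs; when `Q Y ≤ X ^ k / 4` the arcs are pairwise disjoint, so at most one
summand is non-zero (see `upsilon_eq_of_mem`). -/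
def upsilon (k : ℕ) (δ Q X Y α : ℝ) : ℝ :=
  ∑ c ∈ arcIndex Q, (arc k X Y c.1 c.2).indicator
    (fun β => kappa k c.1 ^ 2 * (1 + X ^ k * |β - (c.2 : ℝ) / c.1|) ^ (-δ)) α

theorem arc_unique {k : ℕ} {Q X Y : ℝ} (hQ : 1 ≤ Q) (hX : 1 ≤ X) (hY : 0 < Y)
    (hQY : Q * Y ≤ X ^ k / 4) {q a q' a' : ℕ} (h : (q, a) ∈ arcIndex Q)
    (h' : (q', a') ∈ arcIndex Q) {α : ℝ} (hα : α ∈ arc k X Y q a) (hα' : α ∈ arc k X Y q' a') :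
    (q, a) = (q', a') := by
  have hQ0 : 0 ≤ Q := by linarith
  obtain ⟨_, hqQ, hc⟩ := (mem_arcIndex hQ0).1 h
  obtain ⟨_, hqQ', hc'⟩ := (mem_arcIndex hQ0).1 h'
  have hXk : 0 < X ^ k := by positivity
  have hη : Q * (Y / X ^ k) ≤ 1 / 4 := by
    rw [← mul_div_assoc, div_le_iff₀ hXk]; linarith
  have hη0 : 0 ≤ Y / X ^ k := by positivity
  have e1 := hα.2
  have e2 := hα'.2
  have b1 : |(q' : ℝ) * (q * α - a)| ≤ 1 / 4 := by
    rw [abs_mul, Nat.abs_cast]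
    exact (mul_le_mul hqQ' e1 (abs_nonneg _) hQ0).trans hη
  have b2 : |(q : ℝ) * (q' * α - a')| ≤ 1 / 4 := by
    rw [abs_mul, Nat.abs_cast]
    exact (mul_le_mul hqQ e2 (abs_nonneg _) hQ0).trans hη
  have hcross : (a * q' : ℕ) = a' * q := by
    have hz : |((a : ℤ) * q' - a' * q)| < 1 := by
      have : |((a : ℝ) * q' - a' * q)| < 1 := by
        rw [abs_le] at b1 b2
        rw [abs_lt]
        constructor <;> nlinarith
      exact_mod_cast this
    have := Int.abs_lt_one_iff.1 hz
    have h0 : (a : ℤ) * q' = a' * q := by linarith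
    exact_mod_cast h0
  have d1 : q ∣ q' := by
    have : q ∣ a * q' := ⟨a', by rw [hcross]; ring⟩
    exact (Nat.Coprime.symm hc).dvd_of_dvd_mul_left this
  have d2 : q' ∣ q := by
    have : q' ∣ a' * q := ⟨a, by rw [← hcross]; ring⟩
    exact (Nat.Coprime.symm hc').dvd_of_dvd_mul_left this
  have hq : q = q' := Nat.dvd_antisymm d1 d2
  subst hq
  rcases Nat.eq_zero_or_pos q with h0 | h0
  · subst h0
    have := (Nat.coprime_zero_right a).1 hc
    omega
  · rw [Nat.eq_of_mul_eq_mul_right h0 hcross]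

theorem upsilon_eq_of_mem {k : ℕ} {δ Q X Y : ℝ} (hQ : 1 ≤ Q) (hX : 1 ≤ X) (hY : 0 < Y)
    (hQY : Q * Y ≤ X ^ k / 4) {q a : ℕ} (h : a ≤ q ∧ (q : ℝ) ≤ Q ∧ a.Coprime q) {α : ℝ}
    (hα : α ∈ arc k X Y q a) :
    upsilon k δ Q X Y α = kappa k q ^ 2 * (1 + X ^ k * |α - (a : ℝ) / q|) ^ (-δ) := by
  have h1 := (mem_arcIndex (by linarith : (0 : ℝ) ≤ Q)).2 h
  unfold upsilon
  rw [Finset.sum_eq_single (q, a)]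
  · rw [Set.indicator_of_mem hα]
  · rintro ⟨q', a'⟩ h2 hne
    refine Set.indicator_of_notMem (fun hα' => hne ?_) _
    exact arc_unique hQ hX hY hQY h2 h1 hα' hα
  · exact fun h2 => absurd h1 h2

/-- The exponential sum `∑_{x ∈ 𝓩} e(α x ^ k)`, where `e(z) = exp(2 π i z)`. -/
def weylSum (k : ℕ) (Z : Finset ℤ) (α : ℝ) : ℂ :=
  ∑ x ∈ Z, Complex.exp (2 * Real.pi * Complex.I * ((α * (x : ℝ) ^ k : ℝ) : ℂ))

end Pruning

end

/-!
Everything in sight is non-negative, so each arc may be completed to the real line, and for fixed `β`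
the sum over the numerators `a` coprime to `q` may be enlarged to all residues `a` modulo `q`. By
orthogonality `∑_{a mod q} |W(a / q + β)| ^ (2t)`, where `W` is the exponential sum over `Z`, is at
most `q N(q)`, where `N(q)` counts the solutions of `∑ x_i ^ k ≡ ∑ y_i ^ k (mod q)` in `2t`
variables; this count increases if `Z` is replaced by an interval `{0, …, M - 1}` with `M ≪ X`
(`integral_upsilon_mul_le`). It remains to bound `∑_{q ≤ n} κ(q) ^ 2 q N(q)` by
`n ^ ε (M ^ (2t) + n ^ (t + 1))`, which is `sum_kappa_sq_mul_congCount_le`.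

Locally, the density `q N(q) / q ^ (2t)` of a complete box is at most `A ^ ω(q) P(q)`, where `P(q)` is
the largest `d` with `d ^ k ∣ q` (`congCount_box_le`); this is where `t ≥ ⌊k / 2⌋` is needed. Since
`κ(q) ^ 2 P(q) ≤ k ^ (2 ω(q)) / rad q` and `∑_{q ≤ n} 1 / rad q ≪ n ^ ε`, the case `n ≤ M` follows
by covering the box with complete residue systems.

Let `n > M`, so that divisor functions of the integers `h = ∑ x_i ^ k - ∑ y_i ^ k` are `≪ n ^ ε`. The
tuples with `h = 0` number `≪ M ^ (2t - 2 + ε)` for `t ≥ 2` (`card_zeros_le`), and contribute this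
times `n ^ (1 + ε)`. For `h ≠ 0` write `q = r D ^ 2` with `r` squarefree. The weight `κ(q) ^ 2 q` is
then essentially free of `r`, and the sum over `r ∣ h` costs only a divisor function. So only square
moduli `D ^ 2 ≤ n` remain, and for these the substitution `x = u + D y`, which makes the phase of
`W(b / D ^ 2)` linear in `y`, shows that `W(b / D ^ 2)` agrees with its expected main term up to
`D ^ (1 + ε)` (`norm_weylSum_square_sub_le`). This is square root cancellation, and no
estimate for complete exponential sums to prime moduli is required. The error terms give rise to
`n ^ (t + 1 + ε)`.
-/

namespace Pruning

/-! ### Divisor-type bounds and the sum of reciprocals of radicals -/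

/-- The common source of the bounds `τ(n) ≪ n ^ ε` and `A ^ ω(n) ≪ n ^ ε`: only the primes with
`p ^ ε < 2A` cost more than `p ^ (ε l)`, each of them a bounded factor. -/
theorem prod_primeFactors_mul_succ_le (A : ℝ) (hA : 1 ≤ A) {ε : ℝ} (hε : 0 < ε) :
    ∃ C : ℝ, 1 ≤ C ∧ ∀ n : ℕ, n ≠ 0 →
      ∏ p ∈ n.primeFactors, (A * (n.factorization p + 1)) ≤ C * (n : ℝ) ^ ε := by
  -- `C₀` is the loss at a single prime
  obtain ⟨C₀, hC₀, hC⟩ : ∃ C₀ : ℝ, 1 ≤ C₀ ∧ ∀ l : ℕ, A * (l + 1) ≤ C₀ * ((2 : ℝ) ^ ε) ^ l := by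
    have h2 : 1 < (2 : ℝ) ^ ε := Real.one_lt_rpow (by norm_num) hε
    have h0 : 0 < (2 : ℝ) ^ ε - 1 := by linarith
    refine ⟨A * (1 + 1 / ((2 : ℝ) ^ ε - 1)), ?_, fun l => ?_⟩
    · have : 0 ≤ 1 / ((2 : ℝ) ^ ε - 1) := by positivity
      nlinarith
    · rw [mul_assoc]
      refine mul_le_mul_of_nonneg_left ?_ (by linarith)
      have hb := one_add_mul_le_pow (a := (2 : ℝ) ^ ε - 1) (by linarith) l
      have hb' : 1 + (l : ℝ) * ((2 : ℝ) ^ ε - 1) ≤ ((2 : ℝ) ^ ε) ^ l := by simpa using hb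
      have h1 : (1 : ℝ) ≤ ((2 : ℝ) ^ ε) ^ l := one_le_pow₀ h2.le
      have h3 : (l : ℝ) ≤ 1 / ((2 : ℝ) ^ ε - 1) * ((2 : ℝ) ^ ε) ^ l := by
        rw [div_mul_eq_mul_div, one_mul, le_div_iff₀ h0]
        linarith
      linarith
  obtain ⟨P, hP⟩ : ∃ P : ℕ, 2 * A ≤ (P : ℝ) ^ ε := by
    have := (tendsto_rpow_atTop hε).comp tendsto_natCast_atTop_atTop
    exact (this.eventually_ge_atTop (2 * A)).exists
  refine ⟨C₀ ^ P, one_le_pow₀ hC₀, fun n hn => ?_⟩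
  have hn' : (n : ℝ) ^ ε = ∏ p ∈ n.primeFactors, ((p : ℝ) ^ ε) ^ n.factorization p := by
    conv_lhs => rw [← Nat.prod_factorization_pow_eq_self hn]
    rw [Finsupp.prod, Nat.support_factorization, Nat.cast_prod,
      ← Real.finsetProd_rpow _ _ (fun i _ => by positivity)]
    refine Finset.prod_congr rfl fun p _ => ?_
    rw [Nat.cast_pow, ← Real.rpow_natCast, ← Real.rpow_natCast, ← Real.rpow_mul (by positivity),
      ← Real.rpow_mul (by positivity), mul_comm]
  have hsmall : ∏ p ∈ n.primeFactors, (if p < P then C₀ else 1) ≤ C₀ ^ P := by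
    rw [← Finset.prod_filter, Finset.prod_const]
    refine pow_le_pow_right₀ hC₀ ?_
    calc _ ≤ (Finset.range P).card := Finset.card_le_card fun p hp => by
            simpa using (Finset.mem_filter.1 hp).2
      _ = P := Finset.card_range P
  rw [hn']
  refine le_trans ?_ (mul_le_mul_of_nonneg_right hsmall
    (Finset.prod_nonneg fun _ _ => by positivity))
  rw [← Finset.prod_mul_distrib]
  refine Finset.prod_le_prod (fun _ _ => by positivity) fun p hp => ?_
  have hpp := Nat.prime_of_mem_primeFactors hp
  set l := n.factorization p
  split_ifs with h
  · refine (hC l).trans (mul_le_mul_of_nonneg_left ?_ (by linarith))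
    have : (2 : ℝ) ≤ p := by exact_mod_cast hpp.two_le
    gcongr
  · have hl : 1 ≤ l := (hpp.dvd_iff_one_le_factorization hn).1 (Nat.dvd_of_mem_primeFactors hp)
    have hPp : (P : ℝ) ≤ p := by exact_mod_cast not_lt.1 h
    have h1 : (2 * A) ^ l ≤ ((p : ℝ) ^ ε) ^ l :=
      pow_le_pow_left₀ (by linarith) (hP.trans (by gcongr)) l
    have h2 : ((l : ℝ) + 1) ≤ 2 ^ l := by exact_mod_cast Nat.lt_two_pow_self (n := l)
    have h3 : A ≤ A ^ l := le_self_pow₀ hA (by omega)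
    rw [one_mul]
    refine le_trans ?_ h1
    rw [mul_pow, mul_comm]
    exact mul_le_mul h2 h3 (by linarith) (by positivity)

theorem card_divisors_le_rpow {ε : ℝ} (hε : 0 < ε) :
    ∃ C : ℝ, 1 ≤ C ∧ ∀ n : ℕ, (n.divisors.card : ℝ) ≤ C * (n : ℝ) ^ ε := by
  obtain ⟨C, hC, h⟩ := prod_primeFactors_mul_succ_le 1 le_rfl hε
  refine ⟨C, hC, fun n => ?_⟩
  rcases eq_or_ne n 0 with rfl | hn
  · simp only [Nat.divisors_zero, Finset.card_empty, Nat.cast_zero]; positivity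
  · refine le_trans (le_of_eq ?_) (h n hn)
    rw [Nat.card_divisors hn]
    push_cast
    simp

theorem pow_card_primeFactors_le_rpow (A : ℝ) (hA : 1 ≤ A) {ε : ℝ} (hε : 0 < ε) :
    ∃ C : ℝ, 1 ≤ C ∧ ∀ n : ℕ, n ≠ 0 → A ^ n.primeFactors.card ≤ C * (n : ℝ) ^ ε := by
  obtain ⟨C, hC, h⟩ := prod_primeFactors_mul_succ_le A hA hε
  refine ⟨C, hC, fun n hn => le_trans ?_ (h n hn)⟩
  rw [← Finset.prod_const]
  refine Finset.prod_le_prod (fun _ _ => by linarith) fun p _ => ?_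
  have : (0 : ℝ) ≤ n.factorization p := by positivity
  nlinarith

/-- The reciprocal of the radical of `n` (with value `1` at `n = 0`). -/
noncomputable def invRad (n : ℕ) : ℝ := ∏ p ∈ n.primeFactors, (p : ℝ)⁻¹

theorem invRad_nonneg (n : ℕ) : 0 ≤ invRad n := Finset.prod_nonneg fun _ _ => by positivity

/-- Rankin's trick: weight by `n ^ (-ε)` and compare with an Euler product, whose factor at `p` is
`1 + O(p ^ (-1 - ε))`. -/
theorem sum_invRad_le {ε : ℝ} (hε : 0 < ε) :
    ∃ C : ℝ, 1 ≤ C ∧ ∀ N : ℕ, ∑ n ∈ Finset.Icc 1 N, invRad n ≤ C * (N : ℝ) ^ ε := by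
  let f : ℕ → ℝ := fun n => (n : ℝ) ^ (-ε) * invRad n
  have hf0 : ∀ n, 0 ≤ f n := fun n => mul_nonneg (by positivity) (invRad_nonneg n)
  have hf1 : f 1 = 1 := by simp [f, invRad]
  have hmul : ∀ {m n : ℕ}, m.Coprime n → f (m * n) = f m * f n := by
    intro m n h
    simp only [f, invRad, Nat.cast_mul]
    rw [Real.mul_rpow (by positivity) (by positivity), h.primeFactors_mul,
      Finset.prod_union h.disjoint_primeFactors]
    ring
  have hpow : ∀ {p : ℕ}, p.Prime → ∀ n, f (p ^ (n + 1)) =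
      (p : ℝ)⁻¹ * (p : ℝ) ^ (-ε) * ((p : ℝ) ^ (-ε)) ^ n := by
    intro p hp n
    simp only [f, invRad]
    rw [Nat.primeFactors_prime_pow (by omega) hp, Finset.prod_singleton, Nat.cast_pow,
      ← Real.rpow_natCast, ← Real.rpow_mul (by positivity), mul_comm ((n + 1 : ℕ) : ℝ),
      Real.rpow_mul (by positivity), Real.rpow_natCast, pow_succ]
    ring
  set y : ℝ := (2 : ℝ) ^ (-ε) with hy
  have hy1 : y < 1 := Real.rpow_lt_one_of_one_lt_of_neg (by norm_num) (by linarith)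
  have hpy : ∀ {p : ℕ}, p.Prime → (p : ℝ) ^ (-ε) ≤ y := by
    intro p hp
    exact Real.rpow_le_rpow_of_nonpos (by norm_num) (by exact_mod_cast hp.two_le) (by linarith)
  have hsum : ∀ {p : ℕ}, p.Prime → Summable (fun n => f (p ^ n)) := by
    intro p hp
    rw [← summable_nat_add_iff 1]
    simp only [hpow hp]
    exact (summable_geometric_of_lt_one (by positivity) ((hpy hp).trans_lt hy1)).mul_left _
  have hts : ∀ {p : ℕ}, p.Prime → ∑' n, f (p ^ n) ≤
      Real.exp ((1 - y)⁻¹ * (p : ℝ) ^ (-(1 + ε))) := by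
    intro p hp
    have hp0 : (0 : ℝ) < p := by exact_mod_cast hp.pos
    rw [(hsum hp).tsum_eq_zero_add]
    simp only [hpow hp, pow_zero, hf1]
    rw [tsum_mul_left, tsum_geometric_of_lt_one (by positivity) ((hpy hp).trans_lt hy1)]
    have e1 : (p : ℝ)⁻¹ * (p : ℝ) ^ (-ε) = (p : ℝ) ^ (-(1 + ε)) := by
      rw [neg_add, Real.rpow_add hp0, Real.rpow_neg_one]
    rw [e1, mul_comm, add_comm]
    refine le_trans ?_ (Real.add_one_le_exp _)
    gcongr
    exact hpy hp
  have hz : Summable (fun n : ℕ => (n : ℝ) ^ (-(1 + ε))) :=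
    Real.summable_nat_rpow.2 (by linarith)
  set S := ∑' n : ℕ, (n : ℝ) ^ (-(1 + ε))
  have hS0 : 0 ≤ S := tsum_nonneg fun _ => by positivity
  have h1y : 0 < 1 - y := by linarith
  refine ⟨Real.exp ((1 - y)⁻¹ * S), Real.one_le_exp (by positivity), fun N => ?_⟩
  obtain ⟨hs1, hs2⟩ := EulerProduct.summable_and_hasSum_factoredNumbers_prod_filter_prime_tsum
    hf1 hmul (fun hp => (hsum hp).norm) (Finset.range (N + 1))
  have hprod : ∏ p ∈ Finset.range (N + 1) with p.Prime, ∑' n, f (p ^ n) ≤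
      Real.exp ((1 - y)⁻¹ * S) := by
    refine (Finset.prod_le_prod (fun p _ => tsum_nonneg fun _ => hf0 _)
      fun p hp => hts (Finset.mem_filter.1 hp).2).trans ?_
    rw [← Real.exp_sum, ← Finset.mul_sum]
    gcongr
    exact hz.sum_le_tsum _ fun _ _ => by positivity
  have hle : ∑ n ∈ Finset.Icc 1 N, f n ≤ Real.exp ((1 - y)⁻¹ * S) := by
    refine le_trans ?_ hprod
    rw [← hs2.tsum_eq]
    have hmem : ∀ n ∈ Finset.Icc 1 N, n ∈ Nat.factoredNumbers (Finset.range (N + 1)) := by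
      intro n hn
      rw [Finset.mem_Icc] at hn
      rw [Nat.mem_factoredNumbers']
      intro p hp hd
      have := Nat.le_of_dvd (by omega) hd
      simp; omega
    have := hs2.summable.sum_le_tsum
      ((Finset.Icc 1 N).subtype (· ∈ Nat.factoredNumbers (Finset.range (N + 1))))
      (fun _ _ => hf0 _)
    refine le_trans (le_of_eq ?_) this
    rw [Finset.sum_subtype_of_mem (f := f) hmem]
  rw [← sub_nonneg]
  have : ∑ n ∈ Finset.Icc 1 N, invRad n ≤ ∑ n ∈ Finset.Icc 1 N, (N : ℝ) ^ ε * f n := by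
    refine Finset.sum_le_sum fun n hn => ?_
    rw [Finset.mem_Icc] at hn
    have hn0 : (0 : ℝ) < n := by exact_mod_cast hn.1
    simp only [f]
    rw [← mul_assoc]
    refine le_mul_of_one_le_left (invRad_nonneg n) ?_
    rw [Real.rpow_neg hn0.le, ← div_eq_mul_inv, le_div_iff₀ (by positivity), one_mul]
    have : (n : ℝ) ≤ N := by exact_mod_cast hn.2
    gcongr
  rw [← Finset.mul_sum] at this
  have h2 := mul_le_mul_of_nonneg_left hle (by positivity : (0 : ℝ) ≤ (N : ℝ) ^ ε)
  linarith

/-! ### Exponential sums and the congruence they detect -/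

/-- The additive character `e(x) = exp(2πix)`. -/
noncomputable def e (x : ℝ) : ℂ := Complex.exp (2 * Real.pi * Complex.I * (x : ℂ))

theorem e_add (x y : ℝ) : e (x + y) = e x * e y := by
  rw [e, e, e, ← Complex.exp_add]
  push_cast
  ring_nf

theorem e_zero : e 0 = 1 := by simp [e]

theorem e_int (n : ℤ) : e n = 1 :=
  Complex.exp_eq_one_iff.2 ⟨n, by push_cast; ring⟩

theorem e_eq_one_iff (x : ℝ) : e x = 1 ↔ ∃ n : ℤ, x = n := by
  refine ⟨fun h => ?_, fun ⟨n, hn⟩ => hn ▸ e_int n⟩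
  obtain ⟨n, hn⟩ := Complex.exp_eq_one_iff.1 h
  refine ⟨n, ?_⟩
  rw [mul_comm (n : ℂ)] at hn
  exact_mod_cast mul_left_cancel₀ Complex.two_pi_I_ne_zero hn

theorem norm_e (x : ℝ) : ‖e x‖ = 1 := by
  rw [e, show 2 * (Real.pi : ℂ) * Complex.I * (x : ℂ) = ((2 * Real.pi * x : ℝ) : ℂ) * Complex.I by
    push_cast; ring]
  exact Complex.norm_exp_ofReal_mul_I _

theorem e_nat_mul (n : ℕ) (x : ℝ) : e (n * x) = e x ^ n := by
  rw [e, e, ← Complex.exp_nat_mul]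
  push_cast
  ring_nf

theorem e_sum {ι : Type*} (s : Finset ι) (f : ι → ℝ) : e (∑ i ∈ s, f i) = ∏ i ∈ s, e (f i) := by
  classical
  induction s using Finset.induction_on with
  | empty => simp [e_zero]
  | insert a s ha ih => rw [Finset.sum_insert ha, Finset.prod_insert ha, e_add, ih]

theorem conj_e (x : ℝ) : (starRingEnd ℂ) (e x) = e (-x) := by
  rw [e, e, ← Complex.exp_conj]
  simp [Complex.conj_ofNat]

theorem continuous_e : Continuous e := by unfold e; fun_prop

theorem sum_range_e_div (q : ℕ) (hq : q ≠ 0) (h : ℤ) :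
    ∑ a ∈ Finset.range q, e (a * (h / q : ℝ)) = if (q : ℤ) ∣ h then (q : ℂ) else 0 := by
  have hq' : (q : ℝ) ≠ 0 := by exact_mod_cast hq
  simp only [e_nat_mul]
  split_ifs with hd
  · obtain ⟨m, rfl⟩ := hd
    have : e (((q * m : ℤ) : ℝ) / q) = 1 := by
      rw [e_eq_one_iff]
      exact ⟨m, by push_cast; field_simp⟩
    simp only [this, one_pow, Finset.sum_const, Finset.card_range, nsmul_eq_mul, mul_one]
  · have hne : e ((h : ℝ) / q) ≠ 1 := by
      rw [Ne, e_eq_one_iff]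
      rintro ⟨n, hn⟩
      refine hd ⟨n, ?_⟩
      rw [div_eq_iff hq'] at hn
      have : h = n * q := by exact_mod_cast hn
      rw [this, mul_comm]
    have hone : e ((h : ℝ) / q) ^ q = 1 := by
      rw [← e_nat_mul, mul_div_cancel₀ _ hq']
      exact e_int h
    rw [geom_sum_eq hne, hone, sub_self, zero_div]

theorem norm_e_sub_one (x : ℝ) : ‖e x - 1‖ = 2 * |Real.sin (Real.pi * x)| := by
  rw [e, show 2 * (Real.pi : ℂ) * Complex.I * (x : ℂ) = Complex.I * ((2 * Real.pi * x : ℝ) : ℂ) by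
    push_cast; ring, Complex.norm_exp_I_mul_ofReal_sub_one, norm_mul, Real.norm_eq_abs,
    Real.norm_eq_abs, show 2 * Real.pi * x / 2 = Real.pi * x by ring]
  norm_num

/-- The geometric sum with frequency `v / D` is at most `1 / (2 ‖v / D‖)`; this is bounded here by
the sum of the two possible values `D / v` and `D / (D - v)`. -/
theorem norm_geom_sum_e_le (D v L : ℕ) (hv : 0 < v) (hvD : v < D) :
    ‖∑ y ∈ Finset.range L, e (y * (v / D : ℝ))‖ ≤ (D : ℝ) / v + D / (D - v : ℕ) := by
  have hv0 : (0 : ℝ) < v := by exact_mod_cast hv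
  have hD0 : (0 : ℝ) < D := by exact_mod_cast hv.trans hvD
  have hvD' : (v : ℝ) < D := by exact_mod_cast hvD
  have hw0 : (0 : ℝ) < (D : ℝ) - v := by linarith
  rw [Nat.cast_sub hvD.le]
  set x : ℝ := v / D with hx
  have hx0 : 0 < x := by positivity
  have hx1 : x < 1 := by rw [hx, div_lt_one hD0]; exact hvD'
  have hpi := Real.pi_pos
  have key : ∀ z : ℝ, 0 < z → z ≤ 1 / 2 → 2 * z ≤ Real.sin (Real.pi * z) := by
    intro z hz hz2
    have := Real.mul_le_sin (x := Real.pi * z) (by positivity) (by nlinarith)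
    refine le_trans (le_of_eq ?_) this
    field_simp
  have hne : e x ≠ 1 := by
    intro h
    obtain ⟨n, hn⟩ := (e_eq_one_iff x).1 h
    rw [hn] at hx0 hx1
    have h1 : (0 : ℤ) < n := by exact_mod_cast hx0
    have h2 : n < 1 := by exact_mod_cast hx1
    omega
  simp only [e_nat_mul]
  rw [geom_sum_eq hne, norm_div, norm_e_sub_one]
  have hnum : ‖e x ^ L - 1‖ ≤ 2 := by
    refine (norm_sub_le _ _).trans ?_
    rw [norm_pow, norm_e]
    norm_num
  have fin : ∀ z : ℝ, 0 < z → 2 * z ≤ |Real.sin (Real.pi * x)| →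
      ‖e x ^ L - 1‖ / (2 * |Real.sin (Real.pi * x)|) ≤ 1 / z := by
    intro z hz hs
    rw [div_le_div_iff₀ (by linarith) hz]
    nlinarith
  rcases le_total x (1 / 2) with h | h
  · have h1 := fin x hx0 ((key x hx0 h).trans (le_abs_self _))
    have h2 : 1 / x = (D : ℝ) / v := by rw [hx, one_div_div]
    have h3 : 0 ≤ (D : ℝ) / (D - v) := by positivity
    linarith
  · have h0 := key (1 - x) (by linarith) (by linarith)
    rw [mul_sub Real.pi, mul_one, Real.sin_pi_sub] at h0
    have h1 := fin (1 - x) (by linarith) (h0.trans (le_abs_self _))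
    have h2 : 1 / (1 - x) = (D : ℝ) / (D - v) := by rw [hx]; field_simp
    have h3 : 0 ≤ (D : ℝ) / v := by positivity
    linarith

theorem weylSum_eq (k : ℕ) (Z : Finset ℤ) (α : ℝ) :
    weylSum k Z α = ∑ x ∈ Z, e (α * (x : ℝ) ^ k) := rfl

theorem continuous_weylSum (k : ℕ) (Z : Finset ℤ) : Continuous (weylSum k Z) := by
  have : weylSum k Z = fun α => ∑ x ∈ Z, e (α * (x : ℝ) ^ k) := rfl
  rw [this]
  exact continuous_finsetSum _ fun x _ => continuous_e.comp (by fun_prop)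

theorem weylSum_add_one (k : ℕ) (Z : Finset ℤ) (α : ℝ) :
    weylSum k Z (α + 1) = weylSum k Z α := by
  rw [weylSum_eq, weylSum_eq]
  refine Finset.sum_congr rfl fun x _ => ?_
  rw [add_mul, e_add, one_mul, show ((x : ℝ) ^ k) = ((x ^ k : ℤ) : ℝ) by push_cast; rfl, e_int,
    mul_one]

/-- The diagonal form `∑ x_i ^ k - ∑ y_i ^ k` in `2t` variables; the variables `x_i` are indexed by
the left copy of `Fin t` and the `y_i` by the right one. -/
def powForm (k : ℕ) {t : ℕ} (x : Fin t ⊕ Fin t → ℤ) : ℤ :=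
  ∑ i, (Sum.elim (fun _ => 1) (fun _ => -1) i : ℤ) * x i ^ k

theorem powForm_eq (k : ℕ) {t : ℕ} (x : Fin t ⊕ Fin t → ℤ) :
    powForm k x = ∑ i, x (Sum.inl i) ^ k - ∑ i, x (Sum.inr i) ^ k := by
  simp [powForm, sub_eq_add_neg]

/-- All `2t`-tuples of elements of `S`. -/
abbrev tuples (t : ℕ) (S : Finset ℤ) : Finset (Fin t ⊕ Fin t → ℤ) :=
  Fintype.piFinset fun _ => S

/-- The number of solutions in `S` of the congruence `∑ x_i ^ k ≡ ∑ y_i ^ k (mod q)`. -/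
def congCount (k t q : ℕ) (S : Finset ℤ) : ℕ :=
  ((tuples t S).filter fun x => (q : ℤ) ∣ powForm k x).card

theorem congCount_mono {k t q : ℕ} {S T : Finset ℤ} (h : S ⊆ T) :
    congCount k t q S ≤ congCount k t q T :=
  Finset.card_le_card (Finset.filter_subset_filter _ (Fintype.piFinset_subset _ _ fun _ => h))

theorem norm_weylSum_pow (k t : ℕ) (Z : Finset ℤ) (α : ℝ) :
    ((‖weylSum k Z α‖ ^ (2 * t) : ℝ) : ℂ) = ∑ x ∈ tuples t Z, e (α * powForm k x) := by
  have h1 : ((‖weylSum k Z α‖ ^ (2 * t) : ℝ) : ℂ) =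
      ∏ i : Fin t ⊕ Fin t, ∑ x ∈ Z,
        e (α * ((Sum.elim (fun _ => 1) (fun _ => -1) i : ℤ) * x ^ k : ℤ)) := by
    rw [Fintype.prod_sum_type]
    simp only [Sum.elim_inl, Sum.elim_inr, Finset.prod_const, Finset.card_univ, Fintype.card_fin]
    rw [← mul_pow, pow_mul]
    push_cast
    congr 1
    rw [← Complex.mul_conj', weylSum_eq, map_sum]
    simp only [conj_e]
    congr 1
    · simp
    · simp
  rw [h1, Finset.prod_univ_sum]
  refine Finset.sum_congr rfl fun x _ => ?_
  rw [← e_sum, powForm]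
  push_cast
  rw [Finset.mul_sum]

theorem sum_norm_weylSum_pow (k t q : ℕ) (hq : q ≠ 0) (Z : Finset ℤ) (β : ℝ) :
    ((∑ a ∈ Finset.range q, ‖weylSum k Z (β + a / q)‖ ^ (2 * t) : ℝ) : ℂ) =
      ∑ x ∈ (tuples t Z).filter (fun x => (q : ℤ) ∣ powForm k x), e (β * powForm k x) * q := by
  push_cast [← Complex.ofReal_pow]
  simp only [norm_weylSum_pow]
  rw [Finset.sum_comm, Finset.sum_filter]
  refine Finset.sum_congr rfl fun x _ => ?_
  have : ∀ a : ℕ, e ((β + a / q) * powForm k x) =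
      e (β * powForm k x) * e (a * ((powForm k x : ℝ) / q)) := by
    intro a
    rw [← e_add]
    ring_nf
  simp only [this]
  rw [← Finset.mul_sum, sum_range_e_div q hq]
  split_ifs <;> simp

/-- Summing over *all* numerators, and not only over those coprime to `q`, leaves a quantity that is
monotone in the set `Z`. -/
theorem sum_norm_weylSum_pow_le (k t q : ℕ) (hq : q ≠ 0) (Z : Finset ℤ) (β : ℝ) :
    ∑ a ∈ Finset.range q, ‖weylSum k Z (β + a / q)‖ ^ (2 * t) ≤ q * congCount k t q Z := by
  have h0 : 0 ≤ ∑ a ∈ Finset.range q, ‖weylSum k Z (β + a / q)‖ ^ (2 * t) :=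
    Finset.sum_nonneg fun _ _ => by positivity
  rw [← Real.norm_of_nonneg h0, ← Complex.norm_real, sum_norm_weylSum_pow k t q hq]
  refine (norm_sum_le _ _).trans ?_
  simp [norm_e, congCount, mul_comm]

theorem sum_norm_weylSum_pow_eq (k t q : ℕ) (hq : q ≠ 0) (Z : Finset ℤ) :
    ∑ a ∈ Finset.range q, ‖weylSum k Z (a / q)‖ ^ (2 * t) = q * congCount k t q Z := by
  have h := sum_norm_weylSum_pow k t q hq Z 0
  simp only [zero_add, zero_mul, e_zero, one_mul, Finset.sum_const, nsmul_eq_mul] at h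
  rw [mul_comm (q : ℝ), congCount]
  exact_mod_cast h

/-- The box `{0, 1, …, M - 1}`. -/
def box (M : ℕ) : Finset ℤ := (Finset.range M).map Nat.castEmbedding

theorem mem_box {M : ℕ} {x : ℤ} : x ∈ box M ↔ 0 ≤ x ∧ x < M := by
  simp only [box, Finset.mem_map, Finset.mem_range, Nat.castEmbedding_apply]
  constructor
  · rintro ⟨a, h, rfl⟩; omega
  · rintro ⟨h1, h2⟩; exact ⟨x.toNat, by omega, by simp [h1]⟩

theorem card_box (M : ℕ) : (box M).card = M := by simp [box]

theorem box_mono {M N : ℕ} (h : M ≤ N) : box M ⊆ box N := by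
  intro x; simp only [mem_box]; omega

theorem weylSum_box (k M : ℕ) (α : ℝ) :
    weylSum k (box M) α = ∑ x ∈ Finset.range M, e (α * (x : ℝ) ^ k) := by
  simp [weylSum_eq, box]

theorem sum_range_mul_eq {A : Type*} [AddCommMonoid A] (f : ℕ → A) (D L : ℕ) :
    ∑ x ∈ Finset.range (D * L), f x =
      ∑ u ∈ Finset.range D, ∑ y ∈ Finset.range L, f (u + D * y) := by
  rw [Finset.sum_comm]
  induction L with
  | zero => simp
  | succ L ih =>
    rw [Nat.mul_succ, Finset.sum_range_add, ih, Finset.sum_range_succ]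
    congr 1
    exact Finset.sum_congr rfl fun u _ => by rw [add_comm]

theorem e_eq_of_dvd_sub {q : ℕ} (hq : q ≠ 0) {a b : ℤ} (h : (q : ℤ) ∣ a - b) :
    e ((a : ℝ) / q) = e ((b : ℝ) / q) := by
  obtain ⟨m, hm⟩ := h
  have : (a : ℝ) / q = b / q + m := by
    have : (a : ℝ) = b + q * m := by rw [← sub_eq_iff_eq_add'] ; exact_mod_cast hm
    rw [this]
    have hq' : (q : ℝ) ≠ 0 := by exact_mod_cast hq
    field_simp
  rw [this, e_add, e_int, mul_one]

theorem weylSum_box_mul (k q L a : ℕ) (hq : q ≠ 0) :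
    weylSum k (box (q * L)) (a / q) = L * weylSum k (box q) (a / q) := by
  rw [weylSum_box, weylSum_box, sum_range_mul_eq, Finset.mul_sum]
  refine Finset.sum_congr rfl fun u _ => ?_
  rw [Finset.sum_congr rfl (g := fun _ => e (a / q * (u : ℝ) ^ k))]
  · simp
  · intro y _
    have := e_eq_of_dvd_sub hq (a := a * (u + q * y) ^ k) (b := a * u ^ k) (by
      rw [← mul_sub]
      refine Dvd.dvd.mul_left (dvd_trans ⟨(y : ℤ), ?_⟩ (sub_dvd_pow_sub_pow _ _ k)) _
      ring)
    push_cast at this ⊢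
    rw [div_mul_eq_mul_div, div_mul_eq_mul_div]
    exact this

theorem congCount_box_mul (k t q L : ℕ) (hq : q ≠ 0) :
    congCount k t q (box (q * L)) = L ^ (2 * t) * congCount k t q (box q) := by
  have h1 := sum_norm_weylSum_pow_eq k t q hq (box (q * L))
  have h2 := sum_norm_weylSum_pow_eq k t q hq (box q)
  simp only [weylSum_box_mul k q L _ hq, norm_mul, mul_pow, ← Finset.mul_sum, h2] at h1
  have hq' : (q : ℝ) ≠ 0 := by exact_mod_cast hq
  have : (q : ℝ) * ((L : ℝ) ^ (2 * t) * congCount k t q (box q)) =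
      q * congCount k t q (box (q * L)) := by
    rw [← h1]; simp; ring
  exact_mod_cast (mul_left_cancel₀ hq' this).symm

/-! ### Roots of unity modulo `n`, and counting with fixed coordinates -/

theorem card_pow_eq_one_le_of_index_le_two {G : Type*} [CommGroup G] [Fintype G] [DecidableEq G]
    (H : Subgroup G) [IsCyclic H] (hH : H.index ≤ 2) {m : ℕ} (hm : 0 < m) :
    (Finset.univ.filter fun g : G => g ^ m = 1).card ≤ 2 * m := by
  classical
  have h1 := Finset.card_le_mul_card_image (f := (fun g : G => (g : G ⧸ H)))
    (Finset.univ.filter fun g : G => g ^ m = 1) m ?_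
  · refine h1.trans ?_
    rw [mul_comm]
    refine Nat.mul_le_mul_right _ ((Finset.card_le_univ _).trans ?_)
    rwa [← Nat.card_eq_fintype_card]
  · intro a ha
    obtain ⟨g₀, hg₀, rfl⟩ := Finset.mem_image.1 ha
    rw [Finset.mem_filter] at hg₀
    refine le_trans ?_ (IsCyclic.card_pow_eq_one_le (α := H) hm)
    refine le_trans (Finset.card_le_card (t := (Finset.univ.filter fun h : H => h ^ m = 1).image
      fun h : H => g₀ * h) ?_) Finset.card_image_le
    intro g hg
    simp only [Finset.mem_filter, Finset.mem_univ, true_and, Finset.mem_image] at hg ⊢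
    refine ⟨⟨g₀⁻¹ * g, QuotientGroup.eq.1 hg.2.symm⟩, ?_, by simp⟩
    ext
    simp [mul_pow, hg.1, hg₀.2]

theorem exists_isCyclic_index_le_two (p a : ℕ) (hp : p.Prime) :
    ∃ H : Subgroup (ZMod (p ^ a))ˣ, IsCyclic H ∧ H.index ≤ 2 := by
  have top : IsCyclic (ZMod (p ^ a))ˣ → ∃ H : Subgroup (ZMod (p ^ a))ˣ, IsCyclic H ∧ H.index ≤ 2 :=
    fun h => ⟨⊤, inferInstance, by simp⟩
  rcases eq_or_ne p 2 with rfl | h2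
  · rcases le_or_gt a 2 with ha | ha
    · exact top ((ZMod.isCyclic_units_two_pow_iff a).2 ha)
    · obtain ⟨n, rfl⟩ : ∃ n, a = n + 2 := ⟨a - 2, by omega⟩
      have : NeZero (2 ^ (n + 2)) := ⟨by positivity⟩
      let u : (ZMod (2 ^ (n + 2)))ˣ := ZMod.unitOfCoprime 5
        (Nat.Coprime.pow_right _ (by norm_num))
      refine ⟨Subgroup.zpowers u, inferInstance, ?_⟩
      have hu : orderOf u = 2 ^ n := by
        rw [← ZMod.orderOf_five n, ← orderOf_units]
        simp [u]
      have hc := (Subgroup.zpowers u).card_mul_index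
      rw [Nat.card_zpowers, hu, Nat.card_eq_fintype_card, ZMod.card_units_eq_totient,
        Nat.totient_prime_pow_succ Nat.prime_two] at hc
      have : 2 ^ n * (Subgroup.zpowers u).index = 2 ^ n * 2 := by rw [hc]; ring
      exact (Nat.eq_of_mul_eq_mul_left (by positivity) this).le
  · exact top (ZMod.isCyclic_units_of_prime_pow p hp h2 a)

/-- The number of residues `w` modulo `n`, coprime to `n`, with `w ^ m ≡ r`. -/
def rootCount (m n r : ℕ) : ℕ :=
  ((Finset.range n).filter fun w => w.Coprime n ∧ w ^ m ≡ r [MOD n]).card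

theorem rootCount_prime_pow_le {m : ℕ} (hm : 0 < m) {p : ℕ} (hp : p.Prime) (a r : ℕ) :
    rootCount m (p ^ a) r ≤ 2 * m := by
  classical
  have : NeZero (p ^ a) := ⟨(pow_pos hp.pos a).ne'⟩
  obtain ⟨H, hH, hi⟩ := exists_isCyclic_index_le_two p a hp
  unfold rootCount
  rcases Finset.eq_empty_or_nonempty
    ((Finset.range (p ^ a)).filter fun w => w.Coprime (p ^ a) ∧ w ^ m ≡ r [MOD p ^ a]) with h | h
  · rw [h]; simp
  obtain ⟨w₀, hw₀⟩ := h
  simp only [Finset.mem_filter, Finset.mem_range] at hw₀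
  refine le_trans ?_ (card_pow_eq_one_le_of_index_le_two H hi hm)
  refine le_trans (Finset.card_le_card (t := (Finset.univ.filter
    fun g : (ZMod (p ^ a))ˣ => g ^ m = 1).image
    fun g => ((ZMod.unitOfCoprime w₀ hw₀.2.1 * g : (ZMod (p ^ a))ˣ) : ZMod (p ^ a)).val) ?_)
    Finset.card_image_le
  intro w hw
  simp only [Finset.mem_filter, Finset.mem_range, Finset.mem_univ, true_and,
    Finset.mem_image] at hw ⊢
  refine ⟨(ZMod.unitOfCoprime w₀ hw₀.2.1)⁻¹ * ZMod.unitOfCoprime w hw.2.1, ?_, ?_⟩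
  · rw [mul_pow, inv_pow, inv_mul_eq_one]
    ext
    simp only [Units.val_pow_eq_pow_val, ZMod.coe_unitOfCoprime]
    have := (ZMod.natCast_eq_natCast_iff _ _ _).2 (hw₀.2.2.trans hw.2.2.symm)
    exact_mod_cast this
  · rw [mul_inv_cancel_left, ZMod.coe_unitOfCoprime, ZMod.val_natCast, Nat.mod_eq_of_lt hw.1]

theorem rootCount_mul_le {m a b : ℕ} (hab : a.Coprime b) (ha : a ≠ 0) (hb : b ≠ 0) (r : ℕ) :
    rootCount m (a * b) r ≤ rootCount m a r * rootCount m b r := by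
  unfold rootCount
  rw [← Finset.card_product]
  refine Finset.card_le_card_of_injOn (fun w => (w % a, w % b)) ?_ ?_
  · intro w hw
    simp only [Finset.coe_filter, Finset.mem_range, Set.mem_ofPred_eq, Finset.coe_product,
      Set.mem_prod] at hw ⊢
    obtain ⟨_, h2, h3⟩ := hw
    refine ⟨⟨Nat.mod_lt _ (Nat.pos_of_ne_zero ha), ?_, ?_⟩,
      ⟨Nat.mod_lt _ (Nat.pos_of_ne_zero hb), ?_, ?_⟩⟩
    · rw [Nat.Coprime, ← Nat.gcd_rec, Nat.gcd_comm]
      exact Nat.Coprime.coprime_mul_right_right h2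
    · exact ((Nat.mod_modEq w a).pow m).trans (h3.of_mul_right b)
    · rw [Nat.Coprime, ← Nat.gcd_rec, Nat.gcd_comm]
      exact Nat.Coprime.coprime_mul_left_right h2
    · exact ((Nat.mod_modEq w b).pow m).trans (h3.of_mul_left a)
  · intro w hw w' hw' h
    simp only [Finset.coe_filter, Finset.mem_range, Set.mem_ofPred_eq, Prod.mk.injEq] at hw hw' h
    have := (Nat.modEq_and_modEq_iff_modEq_mul hab).1 ⟨h.1, h.2⟩
    exact Nat.ModEq.eq_of_lt_of_lt this hw.1 hw'.1

theorem rootCount_le {m : ℕ} (hm : 0 < m) (n r : ℕ) (hn : n ≠ 0) :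
    rootCount m n r ≤ (2 * m) ^ n.primeFactors.card := by
  induction n using Nat.recOnPosPrimePosCoprime with
  | prime_pow p a hp ha =>
    rw [Nat.primeFactors_prime_pow ha.ne' hp]
    simpa using rootCount_prime_pow_le hm hp a r
  | zero => exact absurd rfl hn
  | one => simpa [rootCount] using (Finset.card_filter_le _ _).trans (by simp)
  | coprime a b ha hb hab iha ihb =>
    refine (rootCount_mul_le hab (by omega) (by omega) r).trans ?_
    rw [hab.primeFactors_mul, Finset.card_union_of_disjoint hab.disjoint_primeFactors, pow_add]
    exact Nat.mul_le_mul (iha (by omega)) (ihb (by omega))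

/-- If, whenever all coordinates outside `J` are held fixed, at most `B` choices of the coordinates
in `J` give a member of the set, then the set has at most `B |S| ^ |Jᶜ|` members. -/
theorem card_filter_tuples_le {ι : Type*} [Fintype ι] [DecidableEq ι] (S : Finset ℤ)
    (P : (ι → ℤ) → Prop) [DecidablePred P] (J : Finset ι) (B : ℕ)
    (hB : ∀ x : ι → ℤ, P x → ((Fintype.piFinset fun _ : ι => S).filter
      fun y => P y ∧ ∀ i ∉ J, y i = x i).card ≤ B) :
    ((Fintype.piFinset fun _ : ι => S).filter P).card ≤ B * S.card ^ (Fintype.card ι - J.card) := by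
  classical
  have h1 := Finset.card_le_mul_card_image
    (f := (fun (x : ι → ℤ) (i : {i // i ∉ J}) => x i))
    ((Fintype.piFinset fun _ : ι => S).filter P) B ?_
  · refine h1.trans (Nat.mul_le_mul_left _ ?_)
    refine (Finset.card_le_card (t := Fintype.piFinset fun _ : {i // i ∉ J} => S) ?_).trans ?_
    · intro y hy
      obtain ⟨x, hx, rfl⟩ := Finset.mem_image.1 hy
      rw [Finset.mem_filter, Fintype.mem_piFinset] at hx
      rw [Fintype.mem_piFinset]
      exact fun i => hx.1 i
    · rw [Fintype.card_piFinset]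
      simp [Fintype.card_subtype_compl]
  · intro y hy
    obtain ⟨x, hx, rfl⟩ := Finset.mem_image.1 hy
    rw [Finset.mem_filter] at hx
    refine le_trans (Finset.card_le_card ?_) (hB x hx.2)
    intro z hz
    simp only [Finset.mem_filter] at hz ⊢
    exact ⟨hz.1.1, hz.1.2, fun i hi => congrFun hz.2 ⟨i, hi⟩⟩

/-! ### Local densities of the diagonal congruence -/

theorem powForm_sub_eq (k : ℕ) {t : ℕ} (x y : Fin t ⊕ Fin t → ℤ) (J : Finset (Fin t ⊕ Fin t))
    (h : ∀ i ∉ J, y i = x i) :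
    powForm k y - powForm k x =
      ∑ i ∈ J, (Sum.elim (fun _ => 1) (fun _ => -1) i : ℤ) * (y i ^ k - x i ^ k) := by
  rw [powForm, powForm, ← Finset.sum_sub_distrib]
  rw [← Finset.sum_subset (Finset.subset_univ J)]
  · exact Finset.sum_congr rfl fun i _ => by ring
  · intro i _ hi
    rw [h i hi, sub_self]

theorem powForm_const_mul (k : ℕ) {t : ℕ} (c : ℤ) (x : Fin t ⊕ Fin t → ℤ) :
    powForm k (fun i => c * x i) = c ^ k * powForm k x := by
  rw [powForm, powForm, Finset.mul_sum]
  exact Finset.sum_congr rfl fun i _ => by ring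

theorem card_tuples (t : ℕ) (S : Finset ℤ) : (tuples t S).card = S.card ^ (2 * t) := by
  rw [Fintype.card_piFinset]
  simp [two_mul]

/-- Once all other coordinates are fixed, a coordinate prime to `p` is a `k`-th root of a given
residue, and there are at most `2k` of these. -/
theorem card_unit_solutions_le {k : ℕ} (hk : 0 < k) (t : ℕ) {p : ℕ} (hp : p.Prime) (j : ℕ) :
    ((tuples t (box (p ^ j))).filter fun x => ((p ^ j : ℕ) : ℤ) ∣ powForm k x ∧
      ∃ i, ¬ (p : ℤ) ∣ x i).card ≤ 2 * t * (2 * k * (p ^ j) ^ (2 * t - 1)) := by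
  classical
  set q := p ^ j with hq
  have hq0 : 0 < q := pow_pos hp.pos j
  have hsub : ((tuples t (box q)).filter fun x => (q : ℤ) ∣ powForm k x ∧ ∃ i, ¬ (p : ℤ) ∣ x i) ⊆
      Finset.univ.biUnion fun i => (tuples t (box q)).filter fun x =>
        (q : ℤ) ∣ powForm k x ∧ ¬ (p : ℤ) ∣ x i := by
    intro x hx
    simp only [Finset.mem_filter, Finset.mem_biUnion, Finset.mem_univ, true_and] at hx ⊢
    obtain ⟨h1, h2, i, h3⟩ := hx
    exact ⟨i, h1, h2, h3⟩
  refine (Finset.card_le_card hsub).trans ((Finset.card_biUnion_le_card_mul _ _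
    (2 * k * q ^ (2 * t - 1)) fun i _ => ?_).trans (le_of_eq ?_))
  swap
  · simp [two_mul]
  have := card_filter_tuples_le (box q) (fun x : Fin t ⊕ Fin t → ℤ =>
    (q : ℤ) ∣ powForm k x ∧ ¬ (p : ℤ) ∣ x i) {i} (2 * k) ?_
  · simpa [card_box, two_mul] using this
  intro x hx
  refine le_trans ?_ (rootCount_prime_pow_le hk hp j (x i ^ k % (q : ℤ)).toNat)
  rw [rootCount, ← hq]
  refine Finset.card_le_card_of_injOn (fun y => (y i).toNat) ?_ ?_
  · intro y hy
    simp only [Finset.coe_filter, Finset.mem_range, Set.mem_ofPred_eq, Fintype.mem_piFinset,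
      mem_box] at hy ⊢
    obtain ⟨hyS, ⟨hy1, hy2⟩, hy3⟩ := hy
    obtain ⟨w, hw⟩ := Int.eq_ofNat_of_zero_le (hyS i).1
    have hwq := (hyS i).2
    rw [hw] at hwq hy2 ⊢
    rw [Int.toNat_natCast]
    refine ⟨by exact_mod_cast hwq, ?_, ?_⟩
    · rw [hq]
      refine Nat.Coprime.pow_right _ ((Nat.Prime.coprime_iff_not_dvd hp).2 ?_).symm
      exact_mod_cast hy2
    · rw [← Int.natCast_modEq_iff, Int.toNat_of_nonneg (Int.emod_nonneg _ (by omega))]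
      refine Int.ModEq.trans ?_ (Int.mod_modEq _ _).symm
      have h := powForm_sub_eq k x y {i} (by simpa using hy3)
      rw [Finset.sum_singleton] at h
      have hd : (q : ℤ) ∣ (Sum.elim (fun _ => 1) (fun _ => -1) i : ℤ) * (y i ^ k - x i ^ k) := by
        rw [← h]; exact dvd_sub hy1 hx.1
      have hd' : (q : ℤ) ∣ y i ^ k - x i ^ k := by
        rcases i with i | i
        · simpa using hd
        · simpa using (dvd_neg.2 hd)
      rw [hw] at hd'
      push_cast
      exact (Int.modEq_iff_dvd.2 hd').symm
  · intro y hy z hz h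
    simp only [Finset.coe_filter, Set.mem_ofPred_eq, Fintype.mem_piFinset, mem_box] at hy hz h
    funext l
    by_cases hl : l = i
    · subst hl
      have h1 := (hy.1 l).1
      have h2 := (hz.1 l).1
      omega
    · rw [hy.2.2 l (by simpa using hl), hz.2.2 l (by simpa using hl)]

theorem card_nonunit_solutions_le (k t : ℕ) {p : ℕ} (hp : p.Prime) (j d : ℕ)
    (hd : ∀ h : ℤ, ((p ^ (j + 1) : ℕ) : ℤ) ∣ p ^ k * h → (d : ℤ) ∣ h) :
    ((tuples t (box (p ^ (j + 1)))).filter fun x => ((p ^ (j + 1) : ℕ) : ℤ) ∣ powForm k x ∧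
      ∀ i, (p : ℤ) ∣ x i).card ≤ congCount k t d (box (p ^ j)) := by
  have hp0 : (0 : ℤ) < p := by exact_mod_cast hp.pos
  have hx' : ∀ x : Fin t ⊕ Fin t → ℤ, (∀ i, (p : ℤ) ∣ x i) → x = fun i => (p : ℤ) * (x i / p) :=
    fun x h => funext fun i => (Int.mul_ediv_cancel' (h i)).symm
  refine Finset.card_le_card_of_injOn (fun x i => x i / p) ?_ ?_
  · intro x hx
    simp only [Finset.coe_filter, Set.mem_ofPred_eq, Fintype.mem_piFinset, mem_box] at hx ⊢
    obtain ⟨h1, h2, h3⟩ := hx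
    refine ⟨fun i => ⟨Int.ediv_nonneg (h1 i).1 hp0.le, ?_⟩, ?_⟩
    · refine Int.ediv_lt_of_lt_mul hp0 ?_
      have := (h1 i).2
      push_cast [pow_succ] at this ⊢
      exact this
    · refine hd _ ?_
      rw [hx' x h3, powForm_const_mul] at h2
      exact h2
  · intro x hx y hy h
    simp only [Finset.coe_filter, Set.mem_ofPred_eq] at hx hy
    rw [hx' x hx.2.2, hx' y hy.2.2]
    funext i
    exact congrArg ((p : ℤ) * ·) (congrFun h i)

theorem congCount_prime_pow_split (k t : ℕ) (p j : ℕ) (S : Finset ℤ) :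
    congCount k t (p ^ j) S =
      ((tuples t S).filter fun x => ((p ^ j : ℕ) : ℤ) ∣ powForm k x ∧ ∃ i, ¬ (p : ℤ) ∣ x i).card +
      ((tuples t S).filter fun x => ((p ^ j : ℕ) : ℤ) ∣ powForm k x ∧ ∀ i, (p : ℤ) ∣ x i).card := by
  classical
  rw [congCount, ← Finset.card_filter_add_card_filter_not (fun x => ∃ i, ¬ (p : ℤ) ∣ x i)]
  rw [Finset.filter_filter, Finset.filter_filter]
  simp only [not_exists, not_not]

/-- The local density at a prime power: after removing the solutions with a coordinate prime to `p`,
one divides all coordinates by `p` and passes from `p ^ j` to `p ^ (j - k)`. Each such step costs a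
factor `p ^ (k - 2t)`, which is at most `p` because `2t ≥ k - 1`. -/
theorem congCount_prime_pow_le {k t : ℕ} (hk : 3 ≤ k) (ht : k / 2 ≤ t) {p : ℕ} (hp : p.Prime)
    (j : ℕ) : (p : ℝ) ^ j * congCount k t (p ^ j) (box (p ^ j)) ≤
      (4 * t * k + 1) * (2 * (p : ℝ) ^ (j / k) - 1) * ((p : ℝ) ^ j) ^ (2 * t) := by
  have hp1 : (1 : ℝ) ≤ p := by exact_mod_cast hp.one_le
  have hp2 : (2 : ℝ) ≤ p := by exact_mod_cast hp.two_le
  have hp0 : (0 : ℝ) < p := by linarith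
  have ht1 : 1 ≤ t := by omega
  have hkt : k ≤ 2 * t + 1 := by omega
  have hB : (0 : ℝ) ≤ 4 * t * k := by positivity
  have unit : ∀ j : ℕ, (p : ℝ) ^ j * ((tuples t (box (p ^ j))).filter fun x =>
      ((p ^ j : ℕ) : ℤ) ∣ powForm k x ∧ ∃ i, ¬ (p : ℤ) ∣ x i).card ≤
      4 * t * k * ((p : ℝ) ^ j) ^ (2 * t) := by
    intro j
    have h : (((tuples t (box (p ^ j))).filter fun x =>
      ((p ^ j : ℕ) : ℤ) ∣ powForm k x ∧ ∃ i, ¬ (p : ℤ) ∣ x i).card : ℝ) ≤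
      2 * t * (2 * k * ((p : ℝ) ^ j) ^ (2 * t - 1)) := by
      exact_mod_cast card_unit_solutions_le (by omega : 0 < k) t hp j
    refine (mul_le_mul_of_nonneg_left h (by positivity)).trans (le_of_eq ?_)
    conv_rhs => rw [show 2 * t = (2 * t - 1) + 1 by omega, pow_succ]
    ring
  induction j using Nat.strong_induction_on with
  | _ j ih =>
  rcases Nat.eq_zero_or_pos j with rfl | hj
  · have : (congCount k t 1 (box 1) : ℝ) ≤ 1 := by
      have := (Finset.card_filter_le (tuples t (box 1))
        fun x => ((1 : ℕ) : ℤ) ∣ powForm k x).trans (card_tuples t (box 1)).le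
      rw [card_box, one_pow] at this
      exact_mod_cast this
    simp only [pow_zero, Nat.zero_div, one_pow, one_mul, mul_one]
    linarith
  obtain ⟨i, rfl⟩ : ∃ i, j = i + 1 := ⟨j - 1, by omega⟩
  rw [congCount_prime_pow_split]
  push_cast
  rw [mul_add]
  have hu := unit (i + 1)
  push_cast at hu
  rcases Nat.lt_or_ge (i + 1) k with hik | hik
  · have h2 : (((tuples t (box (p ^ (i + 1)))).filter fun x =>
        ((p ^ (i + 1) : ℕ) : ℤ) ∣ powForm k x ∧ ∀ i, (p : ℤ) ∣ x i).card : ℝ) ≤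
        ((p : ℝ) ^ i) ^ (2 * t) := by
      have h := (card_nonunit_solutions_le k t hp i 1 (by simp)).trans
        ((Finset.card_filter_le _ _).trans (card_tuples t _).le)
      rw [card_box] at h
      exact_mod_cast h
    push_cast at h2
    have h3 := mul_le_mul_of_nonneg_left h2 (by positivity : (0 : ℝ) ≤ (p : ℝ) ^ (i + 1))
    have h4 : (p : ℝ) ^ (i + 1) * ((p : ℝ) ^ i) ^ (2 * t) ≤ ((p : ℝ) ^ (i + 1)) ^ (2 * t) := by
      rw [← pow_mul, ← pow_mul, ← pow_add]
      refine pow_le_pow_right₀ hp1 ?_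
      rw [add_mul]
      omega
    rw [Nat.div_eq_of_lt hik, pow_zero]
    linarith
  · obtain ⟨l, hl⟩ : ∃ l, i + 1 = l + k := ⟨i + 1 - k, by omega⟩
    have hil : i = l + (k - 1) := by omega
    have h2 := card_nonunit_solutions_le k t hp i (p ^ l) (by
      intro h hd
      rw [hl] at hd
      push_cast [pow_add] at hd ⊢
      rw [mul_comm ((p : ℤ) ^ l)] at hd
      exact (mul_dvd_mul_iff_left (pow_ne_zero k (Int.natCast_ne_zero.2 hp.ne_zero))).1 hd)
    have hbox : congCount k t (p ^ l) (box (p ^ i)) =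
        (p ^ (k - 1)) ^ (2 * t) * congCount k t (p ^ l) (box (p ^ l)) := by
      rw [hil, pow_add, congCount_box_mul k t _ _ (pow_pos hp.pos l).ne']
    rw [hbox] at h2
    have h2' : (((tuples t (box (p ^ (i + 1)))).filter fun x =>
        ((p ^ (i + 1) : ℕ) : ℤ) ∣ powForm k x ∧ ∀ i, (p : ℤ) ∣ x i).card : ℝ) ≤
        ((p : ℝ) ^ (k - 1)) ^ (2 * t) * congCount k t (p ^ l) (box (p ^ l)) := by
      exact_mod_cast h2
    push_cast at h2'
    have h3 := mul_le_mul_of_nonneg_left h2' (by positivity : (0 : ℝ) ≤ (p : ℝ) ^ (i + 1))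
    have hI := ih l (by omega)
    have hdiv : (i + 1) / k = l / k + 1 := by rw [hl, Nat.add_div_right _ (by omega)]
    rw [hdiv, pow_succ (p : ℝ) (l / k)]
    set s := (p : ℝ) ^ (l / k)
    have hs : 1 ≤ s := one_le_pow₀ hp1
    set B : ℝ := 4 * t * k
    set c : ℝ := (congCount k t (p ^ l) (box (p ^ l)) : ℝ)
    set T : ℝ := ((p : ℝ) ^ (i + 1)) ^ (2 * t) with hT
    have hT0 : 0 < T := by positivity
    have h5 : (p : ℝ) ^ k * ((p : ℝ) ^ (k - 1)) ^ (2 * t) * ((p : ℝ) ^ l) ^ (2 * t) ≤ p * T := by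
      rw [hT, ← pow_mul, ← pow_mul, ← pow_mul, ← pow_add, ← pow_add, ← pow_succ']
      refine pow_le_pow_right₀ hp1 ?_
      rw [show i + 1 = (k - 1) + l + 1 by omega, add_mul, add_mul]
      omega
    have h6 : (p : ℝ) ^ (i + 1) * (((p : ℝ) ^ (k - 1)) ^ (2 * t) * c) ≤
        (B + 1) * (2 * s - 1) * (p * T) := by
      calc (p : ℝ) ^ (i + 1) * (((p : ℝ) ^ (k - 1)) ^ (2 * t) * c)
          = (p : ℝ) ^ k * ((p : ℝ) ^ (k - 1)) ^ (2 * t) * ((p : ℝ) ^ l * c) := by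
            rw [hl, pow_add]; ring
        _ ≤ (p : ℝ) ^ k * ((p : ℝ) ^ (k - 1)) ^ (2 * t) *
            ((B + 1) * (2 * s - 1) * ((p : ℝ) ^ l) ^ (2 * t)) := by gcongr
        _ = (B + 1) * (2 * s - 1) *
            ((p : ℝ) ^ k * ((p : ℝ) ^ (k - 1)) ^ (2 * t) * ((p : ℝ) ^ l) ^ (2 * t)) := by ring
        _ ≤ _ := by
            refine mul_le_mul_of_nonneg_left h5 (mul_nonneg (by linarith) (by linarith))
    refine (add_le_add hu (h3.trans h6)).trans ?_
    have h7 : B + (B + 1) * (2 * s - 1) * p ≤ (B + 1) * (2 * (s * p) - 1) := by nlinarith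
    have := mul_le_mul_of_nonneg_right h7 hT0.le
    linarith

/-- The largest `d` with `d ^ k ∣ q`, as a real number. -/
noncomputable def powPart (k q : ℕ) : ℝ := ∏ p ∈ q.primeFactors, (p : ℝ) ^ (q.factorization p / k)

theorem one_le_powPart (k q : ℕ) : 1 ≤ powPart k q := by
  rw [powPart, ← Finset.prod_const_one (s := q.primeFactors)]
  refine Finset.prod_le_prod (fun _ _ => by positivity) fun p hp => one_le_pow₀ ?_
  exact_mod_cast (Nat.prime_of_mem_primeFactors hp).one_le

theorem powPart_mul {k a b : ℕ} (h : a.Coprime b) :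
    powPart k (a * b) = powPart k a * powPart k b := by
  unfold powPart
  have h1 := Finsupp.prod_add_index_of_disjoint (f1 := a.factorization)
    (f2 := b.factorization) (Nat.Coprime.disjoint_primeFactors h)
    (fun p l => (p : ℝ) ^ (l / k))
  rw [← Nat.factorization_mul_of_coprime h] at h1
  simpa [Finsupp.prod] using h1

/-- Half of the Chinese remainder theorem: reduction modulo `a` and `b` is injective. -/
theorem congCount_mul_le {k t a b : ℕ} (hab : a.Coprime b) (ha : a ≠ 0) (hb : b ≠ 0) :
    congCount k t (a * b) (box (a * b)) ≤
      congCount k t a (box a) * congCount k t b (box b) := by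
  have hmod : ∀ (c : ℕ) (x : Fin t ⊕ Fin t → ℤ), (c : ℤ) ∣ powForm k x →
      (c : ℤ) ∣ powForm k fun i => x i % c := by
    intro c x h
    rw [← dvd_sub_right (a := (c : ℤ)) h, powForm, powForm, ← Finset.sum_sub_distrib]
    refine Finset.dvd_sum fun i _ => ?_
    rw [← mul_sub]
    refine Dvd.dvd.mul_left ?_ _
    exact (Int.modEq_iff_dvd.1 ((Int.mod_modEq (x i) c).pow k))
  unfold congCount
  rw [← Finset.card_product]
  refine Finset.card_le_card_of_injOn (fun x => (fun i => x i % a, fun i => x i % b)) ?_ ?_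
  · intro x hx
    simp only [Finset.coe_filter, Set.mem_ofPred_eq, Fintype.mem_piFinset, Finset.coe_product,
      Set.mem_prod, mem_box] at hx ⊢
    have ha' : (0 : ℤ) < a := by omega
    have hb' : (0 : ℤ) < b := by omega
    obtain ⟨_, h⟩ := hx
    push_cast at h
    exact ⟨⟨fun i => ⟨Int.emod_nonneg _ ha'.ne', Int.emod_lt_of_pos _ ha'⟩,
      hmod a x (dvd_trans (dvd_mul_right _ _) h)⟩,
      fun i => ⟨Int.emod_nonneg _ hb'.ne', Int.emod_lt_of_pos _ hb'⟩,
      hmod b x (dvd_trans (dvd_mul_left _ _) h)⟩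
  · intro x hx y hy h
    simp only [Finset.coe_filter, Set.mem_ofPred_eq, Fintype.mem_piFinset, mem_box,
      Prod.mk.injEq] at hx hy h
    funext i
    have := (Int.modEq_and_modEq_iff_modEq_mul (a := x i) (b := y i) (m := a) (n := b)
      (by simpa using hab)).1 ⟨congrFun h.1 i, congrFun h.2 i⟩
    have h1 := hx.1 i
    have h2 := hy.1 i
    push_cast at h1 h2
    rw [Int.ModEq, Int.emod_eq_of_lt h1.1 h1.2, Int.emod_eq_of_lt h2.1 h2.2] at this
    exact this

theorem congCount_box_le {k t : ℕ} (hk : 3 ≤ k) (ht : k / 2 ≤ t) (q : ℕ) (hq : q ≠ 0) :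
    (q : ℝ) * congCount k t q (box q) ≤
      (2 * (4 * t * k + 1)) ^ q.primeFactors.card * powPart k q * (q : ℝ) ^ (2 * t) := by
  have hB : (0 : ℝ) ≤ 4 * t * k := by positivity
  have pp : ∀ n, 0 ≤ powPart k n := fun n => zero_le_one.trans (one_le_powPart k n)
  induction q using Nat.recOnPosPrimePosCoprime with
  | prime_pow p a hp ha =>
    have := congCount_prime_pow_le hk ht hp a
    rw [powPart, Nat.primeFactors_prime_pow ha.ne' hp, Finset.prod_singleton, Finset.card_singleton,
      pow_one, hp.factorization_pow, Finsupp.single_eq_same]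
    push_cast
    refine this.trans (mul_le_mul_of_nonneg_right ?_ (by positivity))
    linarith
  | zero => exact absurd rfl hq
  | one =>
    have hc : (congCount k t 1 (box 1) : ℝ) ≤ 1 := by
      have := (Finset.card_filter_le (tuples t (box 1))
        fun x => ((1 : ℕ) : ℤ) ∣ powForm k x).trans (card_tuples t (box 1)).le
      rw [card_box, one_pow] at this
      exact_mod_cast this
    simpa [powPart] using hc
  | coprime a b ha hb hab iha ihb =>
    have ha0 : a ≠ 0 := by omega
    have hb0 : b ≠ 0 := by omega
    have h1 : (congCount k t (a * b) (box (a * b)) : ℝ) ≤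
        congCount k t a (box a) * congCount k t b (box b) := by
      exact_mod_cast congCount_mul_le hab ha0 hb0
    rw [hab.primeFactors_mul, Finset.card_union_of_disjoint hab.disjoint_primeFactors, pow_add,
      powPart_mul hab]
    push_cast
    calc (a : ℝ) * b * congCount k t (a * b) (box (a * b))
        ≤ (a : ℝ) * b * (congCount k t a (box a) * congCount k t b (box b)) := by gcongr
      _ = (a * congCount k t a (box a)) * (b * congCount k t b (box b)) := by ring
      _ ≤ _ := mul_le_mul (iha ha0) (ihb hb0) (by positivity)
          (mul_nonneg (mul_nonneg (by positivity) (pp a)) (by positivity))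
      _ = _ := by ring

/-! ### Weyl sums with square denominators -/

/-- The solutions `u` with `gcd(u, D) = g` are `u = g w`, and the congruence then determines `w ^ m`
modulo `D / gcd(c g ^ m, D)`. -/
theorem card_mul_pow_modEq_le {m : ℕ} (hm : 0 < m) (c D v : ℕ) (hD : 0 < D) :
    ((Finset.range D).filter fun u => c * u ^ m ≡ v [MOD D]).card ≤
      Nat.gcd v D * (D.divisors.card * (2 * m) ^ D.primeFactors.card) := by
  have hsub : ((Finset.range D).filter fun u => c * u ^ m ≡ v [MOD D]) ⊆
      D.divisors.biUnion fun g => (Finset.range D).filter fun u =>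
        u.gcd D = g ∧ c * u ^ m ≡ v [MOD D] := by
    intro u hu
    simp only [Finset.mem_filter, Finset.mem_biUnion, Nat.mem_divisors] at hu ⊢
    exact ⟨u.gcd D, ⟨Nat.gcd_dvd_right _ _, hD.ne'⟩, hu.1, rfl, hu.2⟩
  refine (Finset.card_le_card hsub).trans ((Finset.card_biUnion_le_card_mul _ _
    (Nat.gcd v D * (2 * m) ^ D.primeFactors.card) fun g hg => ?_).trans (le_of_eq (by ring)))
  rcases Finset.eq_empty_or_nonempty ((Finset.range D).filter fun u =>
        u.gcd D = g ∧ c * u ^ m ≡ v [MOD D]) with h | ⟨u₀, hu₀⟩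
  · rw [h]; simp
  simp only [Finset.mem_filter, Finset.mem_range] at hu₀
  obtain ⟨-, hg₀, hv₀⟩ := hu₀
  have hgD : g ∣ D := (Nat.mem_divisors.1 hg).1
  have hg0 : 0 < g := Nat.pos_of_dvd_of_pos hgD hD
  set G := D.gcd (c * g ^ m) with hG
  have hGD : G ∣ D := Nat.gcd_dvd_left _ _
  have hG0 : 0 < G := Nat.pos_of_dvd_of_pos hGD hD
  have hgG : g ∣ G := Nat.dvd_gcd hgD (Dvd.dvd.mul_left (dvd_pow_self g hm.ne') c)
  have hD' : D / G ∣ D / g := Nat.div_dvd_div_left hGD hgG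
  have hD'0 : 0 < D / G := Nat.div_pos (Nat.le_of_dvd hD hGD) hG0
  have factor : ∀ u, u.gcd D = g → u = g * (u / g) := fun u hu =>
    (Nat.mul_div_cancel' (hu ▸ Nat.gcd_dvd_left u D)).symm
  have expand : ∀ u, u.gcd D = g → c * u ^ m = c * g ^ m * (u / g) ^ m := by
    intro u hu
    conv_lhs => rw [factor u hu]
    ring
  have hGv : G ∣ Nat.gcd v D := by
    refine Nat.dvd_gcd ?_ hGD
    refine (Nat.ModEq.dvd_iff hv₀ hGD).1 ?_
    rw [expand u₀ hg₀]
    exact Dvd.dvd.mul_right (Nat.gcd_dvd_right _ _) _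
  have hGle : G ≤ Nat.gcd v D := Nat.le_of_dvd (Nat.gcd_pos_of_pos_right _ hD) hGv
  have hroot : rootCount m (D / G) ((u₀ / g) ^ m) ≤ (2 * m) ^ D.primeFactors.card :=
    (rootCount_le hm _ _ hD'0.ne').trans (Nat.pow_le_pow_right (by omega)
      (Finset.card_le_card (Nat.primeFactors_mono (Nat.div_dvd_of_dvd hGD) hD.ne')))
  refine le_trans ?_ (Nat.mul_le_mul ((Finset.card_range G).trans_le hGle) hroot)
  rw [rootCount, ← Finset.card_product]
  refine Finset.card_le_card_of_injOn (fun u => (u / g / (D / G), u / g % (D / G))) ?_ ?_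
  · intro u hu
    simp only [Finset.coe_filter, Finset.mem_range, Set.mem_ofPred_eq, Finset.coe_product,
      Set.mem_prod, Finset.coe_range, Set.mem_Iio] at hu ⊢
    obtain ⟨h1, h2, h3⟩ := hu
    refine ⟨?_, Nat.mod_lt _ hD'0, ?_, ?_⟩
    · rw [Nat.div_lt_iff_lt_mul hD'0, Nat.mul_div_cancel' hGD]
      exact (Nat.div_le_self _ _).trans_lt h1
    · rw [Nat.Coprime, ← Nat.gcd_rec, Nat.gcd_comm]
      refine Nat.Coprime.coprime_dvd_right hD' ?_
      have := Nat.coprime_div_gcd_div_gcd (m := u) (n := D) (by rw [h2]; exact hg0)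
      rwa [h2] at this
    · refine ((Nat.mod_modEq _ _).pow m).trans ?_
      refine Nat.ModEq.cancel_left_div_gcd hD (c := c * g ^ m) ?_
      rw [← expand u h2, ← expand u₀ hg₀]
      exact h3.trans hv₀.symm
  · intro u hu u' hu' h
    simp only [Finset.coe_filter, Finset.mem_range, Set.mem_ofPred_eq, Prod.mk.injEq] at hu hu' h
    rw [factor u hu.2.1, factor u' hu'.2.1, ← Nat.div_add_mod (u / g) (D / G),
      ← Nat.div_add_mod (u' / g) (D / G), h.1, h.2]

theorem sum_gcd_div_le (D : ℕ) (hD : 0 < D) :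
    ∑ v ∈ Finset.Ico 1 D, (Nat.gcd v D : ℝ) / v ≤ D.divisors.card * (1 + Real.log D) := by
  have hH : ∑ w ∈ Finset.Icc 1 D, (w : ℝ)⁻¹ ≤ 1 + Real.log D := by
    have := harmonic_le_one_add_log D
    rw [harmonic_eq_sum_Icc] at this
    push_cast at this
    exact this
  calc ∑ v ∈ Finset.Ico 1 D, (Nat.gcd v D : ℝ) / v
      ≤ ∑ v ∈ Finset.Ico 1 D, ∑ g ∈ D.divisors, if g ∣ v then (g : ℝ) / v else 0 := by
        refine Finset.sum_le_sum fun v _ => ?_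
        have := Finset.single_le_sum (f := fun g : ℕ => if g ∣ v then (g : ℝ) / v else 0)
          (fun g _ => by positivity)
          (Nat.mem_divisors.2 ⟨Nat.gcd_dvd_right v D, hD.ne'⟩)
        simpa [Nat.gcd_dvd_left] using this
    _ = ∑ g ∈ D.divisors, ∑ v ∈ (Finset.Ico 1 D).filter (g ∣ ·), (g : ℝ) / v := by
        rw [Finset.sum_comm]
        simp only [Finset.sum_filter]
    _ ≤ ∑ g ∈ D.divisors, ∑ w ∈ Finset.Icc 1 D, (w : ℝ)⁻¹ := by
        refine Finset.sum_le_sum fun g hg => ?_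
        have hg0 : 0 < g := Nat.pos_of_mem_divisors hg
        have hinj : Set.InjOn (fun v => v / g) ((Finset.Ico 1 D).filter (g ∣ ·)) := by
          intro v hv w hw h
          simp only [Finset.coe_filter, Set.mem_ofPred_eq] at hv hw
          rw [← Nat.mul_div_cancel' hv.2, ← Nat.mul_div_cancel' hw.2]
          exact congrArg (g * ·) h
        rw [Finset.sum_congr rfl (g := fun v => (((v / g : ℕ) : ℝ))⁻¹),
          ← Finset.sum_image (f := fun w : ℕ => (w : ℝ)⁻¹) hinj]
        · refine Finset.sum_le_sum_of_subset_of_nonneg ?_ fun _ _ _ => by positivity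
          intro w hw
          obtain ⟨v, hv, rfl⟩ := Finset.mem_image.1 hw
          rw [Finset.mem_filter, Finset.mem_Ico] at hv
          rw [Finset.mem_Icc]
          exact ⟨Nat.div_pos (Nat.le_of_dvd (by omega) hv.2) hg0,
            (Nat.div_le_self _ _).trans hv.1.2.le⟩
        · intro v hv
          rw [Finset.mem_filter] at hv
          have : (g : ℝ) ≠ 0 := by exact_mod_cast hg0.ne'
          rw [Nat.cast_div hv.2 this, inv_div]
    _ ≤ _ := by
        rw [Finset.sum_const, nsmul_eq_mul]
        gcongr

/-- An upper bound for the deviation of `∑ e(b x ^ k / D ^ 2)` over a box from its expected size. -/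
noncomputable def squareErr (k D : ℕ) : ℝ :=
  2 * D * (D.divisors.card * (2 * (k - 1 : ℕ)) ^ D.primeFactors.card) *
    (D.divisors.card * (1 + Real.log D))

theorem sum_div_residue_le {m : ℕ} (hm : 0 < m) (c D : ℕ) (hD : 0 < D) :
    ∑ u ∈ (Finset.range D).filter (fun u => c * u ^ m % D ≠ 0),
      ((D : ℝ) / (c * u ^ m % D : ℕ) + D / (D - c * u ^ m % D : ℕ)) ≤ squareErr (m + 1) D := by
  set K : ℝ := (D.divisors.card : ℝ) * (2 * (m : ℝ)) ^ D.primeFactors.card with hK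
  have hn : ∀ v ∈ Finset.Ico 1 D, ((((Finset.range D).filter (fun u => c * u ^ m % D ≠ 0)).filter
      fun u => c * u ^ m % D = v).card : ℝ) ≤ Nat.gcd v D * K := by
    intro v hv
    rw [Finset.mem_Ico] at hv
    have h1 : (((Finset.range D).filter (fun u => c * u ^ m % D ≠ 0)).filter
      fun u => c * u ^ m % D = v).card ≤
        ((Finset.range D).filter fun u => c * u ^ m ≡ v [MOD D]).card := by
      refine Finset.card_le_card fun u hu => ?_
      simp only [Finset.mem_filter] at hu ⊢
      exact ⟨hu.1.1, by rw [Nat.ModEq, hu.2, Nat.mod_eq_of_lt hv.2]⟩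
    have h2 := h1.trans (card_mul_pow_modEq_le hm c D v hD)
    rw [hK]
    exact_mod_cast h2
  have hmaps : ∀ u ∈ (Finset.range D).filter (fun u => c * u ^ m % D ≠ 0),
      c * u ^ m % D ∈ Finset.Ico 1 D := by
    intro u hu
    rw [Finset.mem_filter] at hu
    rw [Finset.mem_Ico]
    exact ⟨Nat.pos_of_ne_zero hu.2, Nat.mod_lt _ hD⟩
  rw [← Finset.sum_fiberwise_of_maps_to hmaps]
  have hK0 : 0 ≤ K := by positivity
  calc _ = ∑ v ∈ Finset.Ico 1 D, ((((Finset.range D).filter (fun u => c * u ^ m % D ≠ 0)).filter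
      fun u => c * u ^ m % D = v).card : ℝ) * ((D : ℝ) / v + D / (D - v : ℕ)) := by
        refine Finset.sum_congr rfl fun v _ => ?_
        rw [← nsmul_eq_mul, ← Finset.sum_const]
        refine Finset.sum_congr rfl fun u hu => ?_
        rw [(Finset.mem_filter.1 hu).2]
    _ ≤ ∑ v ∈ Finset.Ico 1 D, (D * K * ((Nat.gcd v D : ℝ) / v) +
          D * K * ((Nat.gcd (D - v) D : ℝ) / (D - v : ℕ))) := by
        refine Finset.sum_le_sum fun v hv => ?_
        refine (mul_le_mul_of_nonneg_right (hn v hv) (by positivity)).trans (le_of_eq ?_)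
        rw [Nat.gcd_self_sub_left (Finset.mem_Ico.1 hv).2.le]
        ring
    _ = 2 * D * K * ∑ v ∈ Finset.Ico 1 D, (Nat.gcd v D : ℝ) / v := by
        have hrefl : ∑ v ∈ Finset.Ico 1 D, (Nat.gcd (D - v) D : ℝ) / (D - v : ℕ) =
            ∑ v ∈ Finset.Ico 1 D, (Nat.gcd v D : ℝ) / v := by
          refine Finset.sum_nbij' (fun v => D - v) (fun v => D - v) ?_ ?_ ?_ ?_ ?_ <;>
            simp only [Finset.mem_Ico] <;> intro v hv <;> first | omega | trivial
        rw [Finset.sum_add_distrib, ← Finset.mul_sum, ← Finset.mul_sum, hrefl]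
        ring
    _ ≤ _ := by
        rw [squareErr, Nat.add_sub_cancel, ← hK]
        exact mul_le_mul_of_nonneg_left (sum_gcd_div_le D hD) (by positivity)

theorem sum_block_eq (k D L b u : ℕ) (hD : 0 < D) :
    ∑ y ∈ Finset.range L, e ((b : ℝ) / (D ^ 2 : ℕ) * ((u + D * y : ℕ) : ℝ) ^ k) =
      e ((b : ℝ) / (D ^ 2 : ℕ) * (u : ℝ) ^ k) *
        ∑ y ∈ Finset.range L, e (y * (((b * k * u ^ (k - 1) % D : ℕ) : ℝ) / D)) := by
  rw [Finset.mul_sum]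
  refine Finset.sum_congr rfl fun y _ => ?_
  have hD0 : (D : ℝ) ≠ 0 := by exact_mod_cast hD.ne'
  obtain ⟨r, hr⟩ := Polynomial.powAddExpansion (u : ℤ) (D * y : ℤ) k
  have h1 := e_eq_of_dvd_sub (q := D ^ 2) (by positivity)
    (a := b * ((u + D * y : ℕ) : ℤ) ^ k)
    (b := b * u ^ k + D * (y * (b * k * u ^ (k - 1)))) (by
      push_cast
      rw [hr]
      exact ⟨b * r * y ^ 2, by ring⟩)
  have hv : (D : ℤ) ∣ b * k * u ^ (k - 1) - ((b * k * u ^ (k - 1) % D : ℕ) : ℤ) := by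
    push_cast
    exact (Int.mod_modEq _ _).dvd
  set v := b * k * u ^ (k - 1) % D
  have h2 := e_eq_of_dvd_sub hD.ne' (a := y * (b * k * u ^ (k - 1))) (b := y * (v : ℤ)) (by
    rw [← mul_sub]
    exact Dvd.dvd.mul_left hv _)
  push_cast at h1 h2 ⊢
  rw [div_mul_eq_mul_div, h1, add_div, e_add, div_mul_eq_mul_div, ← mul_div_assoc, ← h2]
  congr 2
  field_simp

/-- On a box whose length is a multiple of `D`, the Weyl sum at `b / D ^ 2` is as expected up to
roughly `D`: writing `x = u + D y` makes the phase linear in `y`. -/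
theorem norm_weylSum_square_sub_le {k : ℕ} (hk : 2 ≤ k) (D L b : ℕ) (hD : 0 < D) :
    ‖weylSum k (box (D * L)) (b / (D ^ 2 : ℕ)) -
      (L / D : ℂ) * weylSum k (box (D ^ 2)) (b / (D ^ 2 : ℕ))‖ ≤ squareErr k D := by
  have hD0 : (D : ℂ) ≠ 0 := by exact_mod_cast hD.ne'
  have split : ∀ L : ℕ, weylSum k (box (D * L)) (b / (D ^ 2 : ℕ)) = ∑ u ∈ Finset.range D,
      e ((b : ℝ) / (D ^ 2 : ℕ) * (u : ℝ) ^ k) *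
        ∑ y ∈ Finset.range L, e (y * (((b * k * u ^ (k - 1) % D : ℕ) : ℝ) / D)) := by
    intro L
    rw [weylSum_box, sum_range_mul_eq]
    exact Finset.sum_congr rfl fun u _ => sum_block_eq k D L b u hD
  obtain ⟨m, rfl⟩ : ∃ m, k = m + 1 := ⟨k - 1, by omega⟩
  rw [split L]
  conv_lhs => rw [pow_two D]
  have := split D
  rw [pow_two] at this
  rw [this, Finset.mul_sum, ← Finset.sum_sub_distrib]
  refine (norm_sum_le _ _).trans (le_trans ?_
    (sum_div_residue_le (by omega : 0 < m) (b * (m + 1)) D hD))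
  rw [Finset.sum_filter]
  refine Finset.sum_le_sum fun u _ => ?_
  rw [Nat.add_sub_cancel]
  set v := b * (m + 1) * u ^ m % D with hv
  rw [mul_left_comm, ← mul_sub, norm_mul, norm_e, one_mul]
  split_ifs with h
  · have h0 : ∑ y ∈ Finset.range D, e (y * ((v : ℝ) / D)) = 0 := by
      have := sum_range_e_div D hD.ne' (v : ℤ)
      rw [if_neg] at this
      · simpa only [Int.cast_natCast] using this
      · intro hd
        have := Nat.le_of_dvd (Nat.pos_of_ne_zero h) (by exact_mod_cast hd)
        have := Nat.mod_lt (b * (m + 1) * u ^ m) hD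
        omega
    rw [h0, mul_zero, sub_zero]
    exact norm_geom_sum_e_le D v L (Nat.pos_of_ne_zero h) (Nat.mod_lt _ hD)
  · have h0 : v = 0 := not_not.1 h
    rw [h0]
    simp [e_zero, div_mul_cancel₀ _ hD0]

theorem add_pow_le_two_pow_mul {a b : ℝ} (ha : 0 ≤ a) (hb : 0 ≤ b) (n : ℕ) :
    (a + b) ^ n ≤ 2 ^ n * (a ^ n + b ^ n) :=
  (add_pow_le ha hb n).trans (mul_le_mul_of_nonneg_right
    (pow_le_pow_right₀ (by norm_num) (Nat.sub_le n 1)) (by positivity))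

/-- The number of solutions of the congruence modulo a square `D ^ 2` has the expected order, up to
an error reflecting square root cancellation in the associated exponential sums. -/
theorem congCount_square_le {k : ℕ} (hk : 2 ≤ k) (t D M : ℕ) (hD : 0 < D) :
    (D : ℝ) ^ 2 * congCount k t (D ^ 2) (box M) ≤
      2 ^ (2 * t) * (((M + D : ℝ) / D ^ 2) ^ (2 * t) *
        ((D : ℝ) ^ 2 * congCount k t (D ^ 2) (box (D ^ 2))) +
          (D : ℝ) ^ 2 * squareErr k D ^ (2 * t)) := by
  set L := M / D + 1 with hL
  have hML : M ≤ D * L := (Nat.lt_mul_div_succ M hD).le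
  have hDL : ((D * L : ℕ) : ℝ) ≤ M + D := by
    rw [hL, mul_add, mul_one]
    exact_mod_cast Nat.add_le_add_right (Nat.mul_div_le M D) D
  have hD0 : (0 : ℝ) < D := by exact_mod_cast hD
  have hmono : (congCount k t (D ^ 2) (box M) : ℝ) ≤ congCount k t (D ^ 2) (box (D * L)) := by
    exact_mod_cast congCount_mono (box_mono hML)
  have h1 := sum_norm_weylSum_pow_eq k t (D ^ 2) (by positivity) (box (D * L))
  have h2 := sum_norm_weylSum_pow_eq k t (D ^ 2) (by positivity) (box (D ^ 2))
  have hE0 : 0 ≤ squareErr k D := (norm_nonneg _).trans (norm_weylSum_square_sub_le hk D L 0 hD)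
  have hLD : (L : ℝ) / D ≤ (M + D) / D ^ 2 := by
    rw [div_le_div_iff₀ hD0 (by positivity)]
    push_cast at hDL
    nlinarith
  have hpt : ∀ b : ℕ, ‖weylSum k (box (D * L)) (b / (D ^ 2 : ℕ))‖ ^ (2 * t) ≤
      2 ^ (2 * t) * (((M + D : ℝ) / D ^ 2) ^ (2 * t) *
        ‖weylSum k (box (D ^ 2)) (b / (D ^ 2 : ℕ))‖ ^ (2 * t) + squareErr k D ^ (2 * t)) := by
    intro b
    have h := norm_weylSum_square_sub_le hk D L b hD
    set w := weylSum k (box (D * L)) (b / (D ^ 2 : ℕ))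
    set w' := weylSum k (box (D ^ 2)) (b / (D ^ 2 : ℕ))
    have h3 : ‖w‖ ≤ (M + D : ℝ) / D ^ 2 * ‖w'‖ + squareErr k D := by
      have h4 : ‖w‖ ≤ ‖w - (L / D : ℂ) * w'‖ + ‖(L / D : ℂ) * w'‖ := by
        simpa using norm_add_le (w - (L / D : ℂ) * w') ((L / D : ℂ) * w')
      have h5 : ‖(L / D : ℂ) * w'‖ = (L : ℝ) / D * ‖w'‖ := by simp
      have h6 := mul_le_mul_of_nonneg_right hLD (norm_nonneg w')
      linarith
    set A := (M + D : ℝ) / D ^ 2 * ‖w'‖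
    have hA0 : 0 ≤ A := by positivity
    set B := squareErr k D
    calc ‖w‖ ^ (2 * t) ≤ (A + B) ^ (2 * t) := by gcongr
      _ ≤ 2 ^ (2 * t) * (A ^ (2 * t) + B ^ (2 * t)) := add_pow_le_two_pow_mul hA0 hE0 _
      _ = _ := by rw [mul_pow]
  have h3 := Finset.sum_le_sum (s := Finset.range (D ^ 2)) fun b _ => hpt b
  rw [h1, ← Finset.mul_sum, Finset.sum_add_distrib, ← Finset.mul_sum, h2, Finset.sum_const,
    Finset.card_range, nsmul_eq_mul] at h3
  push_cast at h3
  exact (mul_le_mul_of_nonneg_left hmono (by positivity)).trans h3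

/-! ### Zeros of the diagonal form -/

theorem card_divisors_natAbs_le (k A : ℕ) {ε : ℝ} (hε : 0 < ε) :
    ∃ C : ℝ, 1 ≤ C ∧ ∀ M : ℕ, 1 ≤ M → ∀ h : ℤ, |h| ≤ A * (M : ℤ) ^ k →
      (h.natAbs.divisors.card : ℝ) ≤ C * (M : ℝ) ^ ε := by
  obtain ⟨C, hC, hdiv⟩ := card_divisors_le_rpow (ε := ε / (k + 1)) (by positivity)
  refine ⟨C * (A + 1 : ℝ) ^ (ε / (k + 1)),
    one_le_mul_of_one_le_of_one_le hC (Real.one_le_rpow (by simp) (by positivity)),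
    fun M hM h hh => (hdiv _).trans ?_⟩
  have hM1 : (1 : ℝ) ≤ M := by exact_mod_cast hM
  have h1 : (h.natAbs : ℝ) ≤ (A + 1) * (M : ℝ) ^ (k + 1) := by
    have h2 : (h.natAbs : ℝ) ≤ A * (M : ℝ) ^ k := by
      rw [Nat.cast_natAbs]
      exact_mod_cast hh
    refine h2.trans (mul_le_mul (by linarith) (pow_le_pow_right₀ hM1 (by omega))
      (by positivity) (by positivity))
  rw [mul_assoc]
  refine mul_le_mul_of_nonneg_left ?_ (by linarith)
  calc (h.natAbs : ℝ) ^ (ε / (k + 1)) ≤ ((A + 1) * (M : ℝ) ^ (k + 1)) ^ (ε / (k + 1)) := by gcongr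
    _ = (A + 1 : ℝ) ^ (ε / (k + 1)) * (M : ℝ) ^ ε := by
        rw [Real.mul_rpow (by positivity) (by positivity), ← Real.rpow_natCast (M : ℝ),
          ← Real.rpow_mul (by positivity)]
        congr 2
        push_cast
        field_simp

theorem pow_add_sub_pow_lt {k : ℕ} (hk : 2 ≤ k) {b x x' : ℤ} (hb : 0 < b) (hx : 0 ≤ x)
    (h : x < x') : (x + b) ^ k - x ^ k < (x' + b) ^ k - x' ^ k := by
  have mono : ∀ n : ℕ, (x + b) ^ n - x ^ n ≤ (x' + b) ^ n - x' ^ n := by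
    intro n
    induction n with
    | zero => simp
    | succ n ih =>
      have h1 : x ^ n ≤ (x + b) ^ n := pow_le_pow_left₀ hx (by linarith) n
      have h2 : x ^ n ≤ x' ^ n := pow_le_pow_left₀ hx h.le n
      have h3 : (x + b) * ((x + b) ^ n - x ^ n) ≤ (x' + b) * ((x' + b) ^ n - x' ^ n) :=
        mul_le_mul (by linarith) ih (by linarith) (by linarith)
      have h4 := mul_le_mul_of_nonneg_left h2 hb.le
      rw [pow_succ, pow_succ, pow_succ, pow_succ]
      nlinarith
  obtain ⟨n, rfl⟩ : ∃ n, k = n + 1 := ⟨k - 1, by omega⟩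
  have h1 : x ^ n < (x + b) ^ n := pow_lt_pow_left₀ (by linarith) hx (by omega)
  have h2 : x ^ n ≤ x' ^ n := pow_le_pow_left₀ hx h.le n
  have h3 : (x + b) * ((x + b) ^ n - x ^ n) < (x' + b) * ((x' + b) ^ n - x' ^ n) :=
    mul_lt_mul (by linarith) (mono n) (by linarith) (by linarith)
  have h4 := mul_le_mul_of_nonneg_left h2 hb.le
  rw [pow_succ, pow_succ, pow_succ, pow_succ]
  nlinarith

/-- A representation of `m ≠ 0` as `x ^ k - y ^ k` is determined by the divisor `x - y` of `m`. -/
theorem card_pow_sub_pow_eq_le {k : ℕ} (hk : 2 ≤ k) (M : ℕ) {m : ℤ} (hm : m ≠ 0) :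
    ((box M ×ˢ box M).filter fun w => w.1 ^ k - w.2 ^ k = m).card ≤ m.natAbs.divisors.card := by
  have hk0 : k ≠ 0 := by omega
  refine Finset.card_le_card_of_injOn (fun w => (w.1 - w.2).natAbs) ?_ ?_
  · intro w hw
    simp only [Finset.coe_filter, Set.mem_ofPred_eq, Finset.mem_coe, Nat.mem_divisors] at hw ⊢
    refine ⟨Int.natAbs_dvd_natAbs.2 ?_, by simpa using hm⟩
    rw [← hw.2]
    exact sub_dvd_pow_sub_pow _ _ _
  · rintro ⟨x, y⟩ hw ⟨x', y'⟩ hw' h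
    simp only [Finset.coe_filter, Set.mem_ofPred_eq, Finset.mem_product, mem_box] at hw hw' h
    obtain ⟨⟨⟨hx, -⟩, hy, -⟩, he⟩ := hw
    obtain ⟨⟨⟨hx', -⟩, hy', -⟩, he'⟩ := hw'
    have pos : ∀ {x y : ℤ}, 0 ≤ x → 0 ≤ y → x ^ k - y ^ k = m → (0 < m ↔ y < x) := by
      intro x y hx hy h
      rw [← h, sub_pos]
      exact pow_lt_pow_iff_left₀ hy hx hk0
    have key : ∀ {b x x' : ℤ}, 0 < b → 0 ≤ x → 0 ≤ x' →
        (x + b) ^ k - x ^ k = (x' + b) ^ k - x' ^ k → x = x' := by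
      intro b x x' hb hx hx' h
      rcases lt_trichotomy x x' with hl | hl | hl
      · exact absurd h (pow_add_sub_pow_lt hk hb hx hl).ne
      · exact hl
      · exact absurd h (pow_add_sub_pow_lt hk hb hx' hl).ne'
    have h1 := pos hx hy he
    have h2 := pos hx' hy' he'
    rcases lt_or_gt_of_ne hm with hneg | hpos
    · have hxy : x ≠ y := by rintro rfl; simp at he; omega
      have hxy' : x' ≠ y' := by rintro rfl; simp at he'; omega
      have hlt : x < y := by omega
      have hlt' : x' < y' := by omega
      have hb : y' = x' + (y - x) := by omega
      have : x = x' := by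
        refine key (b := y - x) (by omega) hx hx' ?_
        rw [← hb, show x + (y - x) = y by ring]
        linarith
      rw [Prod.mk.injEq]
      omega
    · have hlt : y < x := h1.1 hpos
      have hlt' : y' < x' := h2.1 hpos
      have hb : x' = y' + (x - y) := by omega
      have : y = y' := by
        refine key (b := x - y) (by omega) hy hy' ?_
        rw [← hb, show y + (x - y) = x by ring]
        linarith
      rw [Prod.mk.injEq]
      omega

theorem abs_pow_sub_pow_le {k M : ℕ} {x y : ℤ} (hx : x ∈ box M) (hy : y ∈ box M) :
    |x ^ k - y ^ k| ≤ (M : ℤ) ^ k := by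
  rw [mem_box] at hx hy
  have h1 := pow_le_pow_left₀ hx.1 hx.2.le k
  have h2 := pow_le_pow_left₀ hy.1 hy.2.le k
  have h3 := pow_nonneg hx.1 k
  have h4 := pow_nonneg hy.1 k
  rw [abs_le]
  constructor <;> linarith

theorem abs_powForm_le {k t M : ℕ} {x : Fin t ⊕ Fin t → ℤ} (hx : x ∈ tuples t (box M)) :
    |powForm k x| ≤ t * (M : ℤ) ^ k := by
  rw [Fintype.mem_piFinset] at hx
  rw [powForm_eq, ← Finset.sum_sub_distrib]
  refine (Finset.abs_sum_le_sum_abs _ _).trans ?_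
  refine (Finset.sum_le_sum fun i _ => abs_pow_sub_pow_le (hx (Sum.inl i)) (hx (Sum.inr i))).trans ?_
  simp

theorem card_quadruples_le {k : ℕ} (hk : 2 ≤ k) (M T : ℕ)
    (hT : ∀ m : ℤ, m ≠ 0 → ((box M ×ˢ box M).filter fun w => w.1 ^ k - w.2 ^ k = m).card ≤ T)
    (c : ℤ) :
    (((box M ×ˢ box M) ×ˢ (box M ×ˢ box M)).filter fun z =>
      (z.1.1 ^ k - z.1.2 ^ k) + (z.2.1 ^ k - z.2.2 ^ k) = c).card ≤ M ^ 2 + T * M ^ 2 := by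
  classical
  have hk0 : k ≠ 0 := by omega
  rw [← Finset.card_filter_add_card_filter_not (fun z : (ℤ × ℤ) × (ℤ × ℤ) => z.2.1 = z.2.2)]
  refine Nat.add_le_add ?_ ?_
  · rw [pow_two, ← card_box M, ← Finset.card_product, card_box]
    refine Finset.card_le_card_of_injOn (fun z => (z.1.2, z.2.1)) ?_ ?_
    · intro z hz
      simp only [Finset.coe_filter, Set.mem_ofPred_eq, Finset.mem_filter, Finset.mem_product,
        Finset.coe_product, Set.mem_prod, Finset.mem_coe] at hz ⊢
      exact ⟨hz.1.1.1.2, hz.1.1.2.1⟩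
    · rintro ⟨⟨a, b⟩, c, d⟩ hz ⟨⟨a', b'⟩, c', d'⟩ hz' h
      simp only [Finset.coe_filter, Set.mem_ofPred_eq, Finset.mem_filter, Finset.mem_product,
        Prod.mk.injEq, mem_box] at hz hz' h ⊢
      obtain ⟨rfl, rfl⟩ := h
      obtain ⟨⟨⟨⟨⟨ha, -⟩, -⟩, -⟩, h1⟩, rfl⟩ := hz
      obtain ⟨⟨⟨⟨⟨ha', -⟩, -⟩, -⟩, h2⟩, rfl⟩ := hz'
      have : a ^ k = a' ^ k := by linarith
      exact ⟨⟨(pow_left_inj₀ ha ha' hk0).1 this, rfl⟩, rfl, rfl⟩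
  · have h1 := Finset.card_le_mul_card_image (f := Prod.fst)
      ((((box M ×ˢ box M) ×ˢ (box M ×ˢ box M)).filter fun z =>
      (z.1.1 ^ k - z.1.2 ^ k) + (z.2.1 ^ k - z.2.2 ^ k) = c).filter fun z => ¬ z.2.1 = z.2.2) T ?_
    · refine h1.trans (Nat.mul_le_mul_left _ ?_)
      rw [pow_two, ← card_box M, ← Finset.card_product, card_box]
      refine Finset.card_le_card fun w hw => ?_
      obtain ⟨z, hz, rfl⟩ := Finset.mem_image.1 hw
      simp only [Finset.mem_filter, Finset.mem_product] at hz ⊢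
      exact hz.1.1.1
    · intro w hw
      obtain ⟨z₀, hz₀, rfl⟩ := Finset.mem_image.1 hw
      simp only [Finset.mem_filter, Finset.mem_product, mem_box] at hz₀
      have hne : c - (z₀.1.1 ^ k - z₀.1.2 ^ k) ≠ 0 := by
        intro h0
        have : z₀.2.1 ^ k = z₀.2.2 ^ k := by linarith [hz₀.1.2]
        exact hz₀.2 ((pow_left_inj₀ hz₀.1.1.2.1.1 hz₀.1.1.2.2.1 hk0).1 this)
      refine le_trans ?_ (hT _ hne)
      refine Finset.card_le_card_of_injOn Prod.snd ?_ ?_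
      · intro z hz
        simp only [Finset.coe_filter, Set.mem_ofPred_eq, Finset.mem_filter,
          Finset.mem_product] at hz ⊢
        obtain ⟨⟨⟨hz1, hz2⟩, -⟩, hz3⟩ := hz
        rw [hz3] at hz2
        exact ⟨hz1.2, by linarith⟩
      · intro z hz z' hz' h
        simp only [Finset.coe_filter, Set.mem_ofPred_eq] at hz hz'
        exact Prod.ext (hz.2.trans hz'.2.symm) h

/-- The number of zeros of the diagonal form: fixing all but four variables, the remaining four lie
on a diagonal surface, which has few points by the divisor bound. -/
theorem card_zeros_le {k : ℕ} (hk : 2 ≤ k) {t : ℕ} (ht : 2 ≤ t) {ε : ℝ} (hε : 0 < ε) :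
    ∃ C : ℝ, 1 ≤ C ∧ ∀ M : ℕ, 1 ≤ M →
      (((tuples t (box M)).filter fun x => powForm k x = 0).card : ℝ) ≤
        C * (M : ℝ) ^ (2 * t - 2) * (M : ℝ) ^ ε := by
  classical
  obtain ⟨C, hC, hdiv⟩ := card_divisors_natAbs_le k 1 hε
  refine ⟨1 + C, by linarith, fun M hM => ?_⟩
  have hM1 : (1 : ℝ) ≤ M := by exact_mod_cast hM
  set T := ⌊C * (M : ℝ) ^ ε⌋₊ with hT
  have hT' : (T : ℝ) ≤ C * (M : ℝ) ^ ε := Nat.floor_le (by positivity)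
  have hTm : ∀ m : ℤ, m ≠ 0 →
      ((box M ×ˢ box M).filter fun w => w.1 ^ k - w.2 ^ k = m).card ≤ T := by
    intro m hm
    rcases Finset.eq_empty_or_nonempty
      ((box M ×ˢ box M).filter fun w => w.1 ^ k - w.2 ^ k = m) with h | ⟨w, hw⟩
    · rw [h]; simp
    · rw [Finset.mem_filter, Finset.mem_product] at hw
      refine (card_pow_sub_pow_eq_le hk M hm).trans (Nat.le_floor (hdiv M hM m ?_))
      rw [← hw.2]
      simpa using abs_pow_sub_pow_le hw.1.1 hw.1.2
  let i₀ : Fin t := ⟨0, by omega⟩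
  let i₁ : Fin t := ⟨1, by omega⟩
  have hi : i₀ ≠ i₁ := by simp [i₀, i₁]
  let J : Finset (Fin t ⊕ Fin t) := {Sum.inl i₀, Sum.inr i₀, Sum.inl i₁, Sum.inr i₁}
  have hJ : J.card = 4 := by
    simp [J, Finset.card_insert_of_notMem, hi]
  have hcount := card_filter_tuples_le (box M)
    (fun x : Fin t ⊕ Fin t → ℤ => powForm k x = 0) J (M ^ 2 + T * M ^ 2) ?_
  · rw [hJ, card_box, Fintype.card_sum, Fintype.card_fin] at hcount
    have hcount' : (((tuples t (box M)).filter fun x => powForm k x = 0).card : ℝ) ≤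
        ((M : ℝ) ^ 2 + T * (M : ℝ) ^ 2) * (M : ℝ) ^ (t + t - 4) := by exact_mod_cast hcount
    refine hcount'.trans ?_
    have h1 : (M : ℝ) ^ (2 * t - 2) = (M : ℝ) ^ 2 * (M : ℝ) ^ (t + t - 4) := by
      rw [← pow_add]; congr 1; omega
    have h2 : 1 ≤ (M : ℝ) ^ ε := Real.one_le_rpow hM1 hε.le
    have h3 : (1 : ℝ) + T ≤ (1 + C) * (M : ℝ) ^ ε := by linarith
    rw [h1]
    calc ((M : ℝ) ^ 2 + T * (M : ℝ) ^ 2) * (M : ℝ) ^ (t + t - 4)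
        = (1 + T) * ((M : ℝ) ^ 2 * (M : ℝ) ^ (t + t - 4)) := by ring
      _ ≤ ((1 + C) * (M : ℝ) ^ ε) * ((M : ℝ) ^ 2 * (M : ℝ) ^ (t + t - 4)) := by gcongr
      _ = _ := by ring
  · intro x hx
    refine le_trans ?_ (card_quadruples_le hk M T hTm
      ((x (Sum.inl i₀) ^ k - x (Sum.inr i₀) ^ k) + (x (Sum.inl i₁) ^ k - x (Sum.inr i₁) ^ k)))
    refine Finset.card_le_card_of_injOn (fun y => ((y (Sum.inl i₀), y (Sum.inr i₀)),
      (y (Sum.inl i₁), y (Sum.inr i₁)))) ?_ ?_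
    · intro y hy
      simp only [Finset.coe_filter, Set.mem_ofPred_eq, Fintype.mem_piFinset,
        Finset.mem_product] at hy ⊢
      obtain ⟨hy1, hy2, hy3⟩ := hy
      refine ⟨⟨⟨hy1 _, hy1 _⟩, hy1 _, hy1 _⟩, ?_⟩
      have h := powForm_sub_eq k x y J hy3
      rw [hx, hy2] at h
      simp only [J] at h
      rw [Finset.sum_insert (by simp [hi]), Finset.sum_insert (by simp [hi]),
        Finset.sum_insert (by simp), Finset.sum_singleton] at h
      simp only [Sum.elim_inl, Sum.elim_inr] at h
      linarith
    · intro y hy z hz h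
      simp only [Finset.coe_filter, Set.mem_ofPred_eq, Prod.mk.injEq] at hy hz h
      funext i
      by_cases hiJ : i ∈ J
      · simp only [J, Finset.mem_insert, Finset.mem_singleton] at hiJ
        rcases hiJ with rfl | rfl | rfl | rfl
        · exact h.1.1
        · exact h.1.2
        · exact h.2.1
        · exact h.2.2
      · rw [hy.2.2 i hiJ, hz.2.2 i hiJ]

theorem card_zeros_one_le {k : ℕ} (hk : k ≠ 0) (M : ℕ) :
    ((tuples 1 (box M)).filter fun x => powForm k x = 0).card ≤ M := by
  rw [← card_box M]
  conv_lhs => rw [card_box]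
  refine Finset.card_le_card_of_injOn (fun x => x (Sum.inl 0)) ?_ ?_
  · intro x hx
    simp only [Finset.coe_filter, Set.mem_ofPred_eq, Fintype.mem_piFinset] at hx
    exact hx.1 _
  · intro x hx y hy h
    have key : ∀ x : Fin 1 ⊕ Fin 1 → ℤ,
        x ∈ (((tuples 1 (box M)).filter fun x => powForm k x = 0 : Finset _) : Set _) →
        x (Sum.inl 0) = x (Sum.inr 0) := by
      intro x hx
      simp only [Finset.coe_filter, Set.mem_ofPred_eq, Fintype.mem_piFinset, mem_box,
        powForm_eq, Finset.univ_unique, Finset.sum_singleton, Fin.default_eq_zero, sub_eq_zero] at hx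
      exact (pow_left_inj₀ (hx.1 _).1 (hx.1 _).1 hk).1 hx.2
    have h1 := key x hx
    have h2 := key y hy
    dsimp only at h
    funext i
    rcases i with i | i <;> rw [Fin.fin_one_eq_zero i]
    · exact h
    · rw [← h1, ← h2, h]

/-! ### The weight `κ` -/

/-- The square of `κ(p ^ l)` is essentially `p ^ (-2u - 1)` or `p ^ (-2u - 2)`, where
`l - 1 = u k + (v - 1)`, according to whether `v = 1` or not. -/
theorem kappaPrimePow_sq_mul_le {k p l n : ℕ} (hk : 1 ≤ k) (hp : 1 ≤ p)
    (hn : n ≤ if (l - 1) % k = 0 then 2 * ((l - 1) / k) + 1 else 2 * ((l - 1) / k) + 2) :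
    kappaPrimePow k p l ^ 2 * (p : ℝ) ^ n ≤ (k : ℝ) ^ 2 := by
  have hp0 : (0 : ℝ) < p := by exact_mod_cast hp
  have hp1 : (1 : ℝ) ≤ p := by exact_mod_cast hp
  have hk1 : (1 : ℝ) ≤ k := by exact_mod_cast hk
  unfold kappaPrimePow
  split_ifs at hn ⊢ with h
  · set u := (l - 1) / k
    have h1 : ((p : ℝ) ^ (-(u : ℝ) - 1 / 2)) ^ 2 = ((p : ℝ) ^ (2 * u + 1))⁻¹ := by
      rw [← Real.rpow_natCast, ← Real.rpow_mul hp0.le, ← Real.rpow_natCast, ← Real.rpow_neg hp0.le]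
      congr 1
      push_cast
      ring
    rw [mul_pow, h1, mul_assoc]
    refine mul_le_of_le_one_right (by positivity) ?_
    rw [inv_mul_le_iff₀ (by positivity), mul_one]
    exact pow_le_pow_right₀ hp1 hn
  · set u := (l - 1) / k
    have h1 : ((p : ℝ) ^ (-(u : ℝ) - 1)) ^ 2 = ((p : ℝ) ^ (2 * u + 2))⁻¹ := by
      rw [← Real.rpow_natCast, ← Real.rpow_mul hp0.le, ← Real.rpow_natCast, ← Real.rpow_neg hp0.le]
      congr 1
      push_cast
      ring
    rw [h1]
    refine le_trans ?_ (one_le_pow₀ hk1)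
    rw [inv_mul_le_iff₀ (by positivity), mul_one]
    exact pow_le_pow_right₀ hp1 hn

theorem kappa_sq_mul_powPart_le {k : ℕ} (hk : 2 ≤ k) (q : ℕ) (hq : q ≠ 0) :
    kappa k q ^ 2 * powPart k q ≤ ((k : ℝ) ^ 2) ^ q.primeFactors.card * invRad q := by
  rw [kappa, Finsupp.prod, Nat.support_factorization, powPart, invRad, ← Finset.prod_pow,
    ← Finset.prod_mul_distrib, ← Finset.prod_const, ← Finset.prod_mul_distrib]
  refine Finset.prod_le_prod (fun _ _ => by positivity) fun p hp => ?_
  have hpp := Nat.prime_of_mem_primeFactors hp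
  have hl : 1 ≤ q.factorization p :=
    (hpp.dvd_iff_one_le_factorization hq).1 (Nat.dvd_of_mem_primeFactors hp)
  set l := q.factorization p
  have hp0 : (0 : ℝ) < p := by exact_mod_cast hpp.pos
  rw [← div_eq_mul_inv, le_div_iff₀ hp0, mul_assoc, ← pow_succ]
  refine kappaPrimePow_sq_mul_le (by omega) hpp.one_le ?_
  obtain ⟨n, hn⟩ : ∃ n, l = n + 1 := ⟨l - 1, by omega⟩
  rw [hn, Nat.add_sub_cancel]
  split_ifs with h
  · have : (n + 1) / k = n / k := by
      rw [Nat.succ_div, if_neg, add_zero]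
      intro hd
      have h1 := (Nat.dvd_add_right (Nat.dvd_of_mod_eq_zero h)).1 hd
      have := Nat.le_of_dvd one_pos h1
      omega
    omega
  · have : (n + 1) / k ≤ n / k + 1 := by
      rw [Nat.succ_div]; split_ifs <;> omega
    omega

theorem kappa_sq_le {k : ℕ} (hk : 2 ≤ k) (q : ℕ) (hq : q ≠ 0) :
    kappa k q ^ 2 ≤ ((k : ℝ) ^ 2) ^ q.primeFactors.card * invRad q := by
  refine le_trans ?_ (kappa_sq_mul_powPart_le hk q hq)
  exact le_mul_of_one_le_right (by positivity) (one_le_powPart k q)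

/-- The contribution of the squarefree part `r` of the modulus `r D ^ 2` is balanced by `κ`. -/
theorem kappa_sq_mul_squarefree_le {k : ℕ} (hk : 3 ≤ k) {r D : ℕ} (hr : Squarefree r)
    (hD : D ≠ 0) :
    kappa k (r * D ^ 2) ^ 2 * r * powPart k (D ^ 2) ≤
      ((k : ℝ) ^ 2) ^ (r * D ^ 2).primeFactors.card * invRad D := by
  classical
  have hr0 : r ≠ 0 := hr.ne_zero
  have hD2 : D ^ 2 ≠ 0 := pow_ne_zero 2 hD
  set q := r * D ^ 2 with hq
  have hq0 : q ≠ 0 := mul_ne_zero hr0 hD2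
  have hfac : ∀ p, q.factorization p = r.factorization p + 2 * D.factorization p := by
    intro p
    rw [hq, Nat.factorization_mul hr0 hD2, Nat.factorization_pow]
    simp
  have e1 : (r : ℝ) = ∏ p ∈ q.primeFactors, (p : ℝ) ^ r.factorization p := by
    conv_lhs => rw [← Nat.prod_factorization_pow_eq_self hr0]
    rw [Finsupp.prod_of_support_subset (s := q.primeFactors)]
    · push_cast; rfl
    · rw [Nat.support_factorization]
      exact Nat.primeFactors_mono (dvd_mul_right _ _) hq0
    · simp
  have e2 : powPart k (D ^ 2) = ∏ p ∈ q.primeFactors, (p : ℝ) ^ (2 * D.factorization p / k) := by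
    rw [powPart, Finset.prod_subset (Nat.primeFactors_mono (dvd_mul_left (D ^ 2) r) hq0)]
    · simp only [Nat.factorization_pow, Finsupp.smul_apply, smul_eq_mul]
      rfl
    · intro p _ hp
      rw [← Nat.support_factorization, Finsupp.notMem_support_iff] at hp
      rw [hp, Nat.zero_div, pow_zero]
  have e3 : invRad D = ∏ p ∈ q.primeFactors, ((p : ℝ) ^ (min (D.factorization p) 1))⁻¹ := by
    refine Finset.prod_subset_one_on_sdiff
      (Nat.primeFactors_mono (dvd_trans (dvd_pow_self D two_ne_zero) (dvd_mul_left (D ^ 2) r)) hq0)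
      ?_ ?_
    · intro p hp
      rw [Finset.mem_sdiff, ← Nat.support_factorization D, Finsupp.notMem_support_iff] at hp
      simp [hp.2]
    · intro p hp
      have : 1 ≤ D.factorization p := ((Nat.prime_of_mem_primeFactors
        hp).dvd_iff_one_le_factorization hD).1 (Nat.dvd_of_mem_primeFactors hp)
      rw [min_eq_right this, pow_one]
  rw [e1, e2, e3, kappa, Finsupp.prod, Nat.support_factorization, ← Finset.prod_pow,
    ← Finset.prod_mul_distrib, ← Finset.prod_mul_distrib, ← Finset.prod_const,
    ← Finset.prod_mul_distrib]
  refine Finset.prod_le_prod (fun _ _ => by positivity) fun p hp => ?_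
  have hpp := Nat.prime_of_mem_primeFactors hp
  have hl : 1 ≤ q.factorization p :=
    (hpp.dvd_iff_one_le_factorization hq0).1 (Nat.dvd_of_mem_primeFactors hp)
  have hrp : r.factorization p ≤ 1 := hr.natFactorization_le_one p
  have hp0 : (0 : ℝ) < p := by exact_mod_cast hpp.pos
  rw [← div_eq_mul_inv, le_div_iff₀ (by positivity), mul_assoc, mul_assoc, ← pow_add, ← pow_add]
  refine kappaPrimePow_sq_mul_le (by omega) hpp.one_le ?_
  rw [hfac] at hl ⊢
  set ρ := r.factorization p
  set m := D.factorization p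
  have hk0 : 0 < k := by omega
  interval_cases hρ : ρ
  · -- the exponent `2m` is even and positive
    obtain ⟨n, hn⟩ : ∃ n, 2 * m = n + 1 := ⟨2 * m - 1, by omega⟩
    rw [hn]
    simp only [zero_add, Nat.add_sub_cancel]
    split_ifs with h
    · have : (n + 1) / k = n / k := by
        rw [Nat.succ_div, if_neg, add_zero]
        intro hd
        have h1 := (Nat.dvd_add_right (Nat.dvd_of_mod_eq_zero h)).1 hd
        have := Nat.le_of_dvd one_pos h1
        omega
      omega
    · have : (n + 1) / k ≤ n / k + 1 := by
        rw [Nat.succ_div]; split_ifs <;> omega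
      omega
  · rw [Nat.add_sub_cancel_left]
    split_ifs with h
    · rcases Nat.eq_zero_or_pos m with h0 | h0
      · simp [h0]
      · have : 1 ≤ 2 * m / k :=
          Nat.div_pos (Nat.le_of_dvd (by omega) (Nat.dvd_of_mod_eq_zero h)) hk0
        omega
    · omega

/-! ### The mean of the congruence counts -/

theorem squareErr_le {k : ℕ} (hk : 2 ≤ k) {ε : ℝ} (hε : 0 < ε) :
    ∃ C : ℝ, 1 ≤ C ∧ ∀ D : ℕ, 1 ≤ D → squareErr k D ≤ C * D * (D : ℝ) ^ ε := by
  obtain ⟨C₁, hC₁, h₁⟩ := card_divisors_le_rpow (ε := ε / 4) (by positivity)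
  have hk1 : (1 : ℝ) ≤ (k - 1 : ℕ) := by exact_mod_cast (by omega : 1 ≤ k - 1)
  obtain ⟨C₂, hC₂, h₂⟩ := pow_card_primeFactors_le_rpow (2 * (k - 1 : ℕ)) (by linarith)
    (ε := ε / 4) (by positivity)
  set C₃ : ℝ := 1 + 1 / (ε / 4) with hC₃
  have hC₃' : 1 ≤ C₃ := by rw [hC₃]; simp; positivity
  refine ⟨2 * (C₁ * C₂) * (C₁ * C₃), ?_, fun D hD => ?_⟩
  · have := one_le_mul_of_one_le_of_one_le hC₁ hC₂
    have := one_le_mul_of_one_le_of_one_le hC₁ hC₃'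
    nlinarith
  have hD1 : (1 : ℝ) ≤ D := by exact_mod_cast hD
  have hx : 1 ≤ (D : ℝ) ^ (ε / 4) := Real.one_le_rpow hD1 (by positivity)
  have h₃ : 1 + Real.log D ≤ C₃ * (D : ℝ) ^ (ε / 4) := by
    have := Real.log_le_rpow_div (by positivity : (0 : ℝ) ≤ D) (by positivity : 0 < ε / 4)
    rw [hC₃, add_mul, one_mul, one_div_mul_eq_div]
    linarith
  have h₄ : (D : ℝ) ^ ε = ((D : ℝ) ^ (ε / 4)) ^ 4 := by
    rw [← Real.rpow_natCast, ← Real.rpow_mul (by positivity)]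
    congr 1
    push_cast
    ring
  have hlog : 0 ≤ 1 + Real.log D := by linarith [Real.log_nonneg hD1]
  have h₁' := h₁ D
  have h₂' := h₂ D (by omega)
  rw [h₄, squareErr]
  set x := (D : ℝ) ^ (ε / 4)
  calc _ ≤ 2 * D * ((C₁ * x) * (C₂ * x)) * ((C₁ * x) * (C₃ * x)) := by gcongr
    _ = _ := by ring

theorem congCount_square_le_rpow {k t : ℕ} (hk : 3 ≤ k) (ht : k / 2 ≤ t) {ε : ℝ} (hε : 0 < ε) :
    ∃ C : ℝ, 1 ≤ C ∧ ∀ D M n : ℕ, 1 ≤ D → D ^ 2 ≤ n →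
      (D : ℝ) ^ 2 * congCount k t (D ^ 2) (box M) ≤
        C * (n : ℝ) ^ ε * powPart k (D ^ 2) * ((M : ℝ) ^ (2 * t) + (n : ℝ) ^ (t + 1)) := by
  have ht1 : 1 ≤ t := by omega
  have ht0 : (0 : ℝ) < 2 * t := by positivity
  have hB0 : (0 : ℝ) ≤ 4 * t * k := by positivity
  obtain ⟨C₁, hC₁, h₁⟩ := pow_card_primeFactors_le_rpow (2 * (4 * t * k + 1)) (by linarith) hε
  obtain ⟨C₂, hC₂, h₂⟩ := squareErr_le (by omega : 2 ≤ k) (ε := ε / (2 * t)) (by positivity)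
  refine ⟨2 ^ (2 * t) * (2 ^ (2 * t) * C₁ + C₂ ^ (2 * t)), ?_, fun D M n hD hDn => ?_⟩
  · have h1 : (1 : ℝ) ≤ 2 ^ (2 * t) := one_le_pow₀ (by norm_num)
    have h2 : (1 : ℝ) ≤ C₂ ^ (2 * t) := one_le_pow₀ hC₂
    nlinarith [mul_nonneg (by linarith : (0 : ℝ) ≤ 2 ^ (2 * t)) (by linarith : 0 ≤ C₁)]
  have hD1 : (1 : ℝ) ≤ D := by exact_mod_cast hD
  have hD0 : (0 : ℝ) < D := by linarith
  have hDn' : (D : ℝ) ^ 2 ≤ n := by exact_mod_cast hDn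
  have hn1 : (1 : ℝ) ≤ n := (one_le_pow₀ hD1).trans hDn'
  have hDn1 : (D : ℝ) ≤ n := (le_self_pow₀ hD1 two_ne_zero).trans hDn'
  have hP := one_le_powPart k (D ^ 2)
  have hDt : (D : ℝ) ^ (2 * t) ≤ (n : ℝ) ^ t := by rw [pow_mul]; gcongr
  have hnt : (n : ℝ) ^ t ≤ (n : ℝ) ^ (t + 1) := pow_le_pow_right₀ hn1 (by omega)
  -- the expected main term
  have main : ((M + D : ℝ) / D ^ 2) ^ (2 * t) *
      ((D : ℝ) ^ 2 * congCount k t (D ^ 2) (box (D ^ 2))) ≤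
      2 ^ (2 * t) * C₁ * ((n : ℝ) ^ ε * powPart k (D ^ 2) *
        ((M : ℝ) ^ (2 * t) + (n : ℝ) ^ (t + 1))) := by
    have hbox := congCount_box_le hk ht (D ^ 2) (by positivity)
    have hω : (2 * (4 * t * k + 1) : ℝ) ^ (D ^ 2).primeFactors.card ≤ C₁ * (n : ℝ) ^ ε := by
      refine (h₁ (D ^ 2) (by positivity)).trans ?_
      gcongr
    have hMD := add_pow_le_two_pow_mul (by positivity : (0 : ℝ) ≤ M) hD0.le (2 * t)
    push_cast at hbox
    calc _ ≤ ((M + D : ℝ) / D ^ 2) ^ (2 * t) * ((2 * (4 * t * k + 1)) ^ (D ^ 2).primeFactors.card *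
          powPart k (D ^ 2) * ((D : ℝ) ^ 2) ^ (2 * t)) := by gcongr
      _ = (M + D : ℝ) ^ (2 * t) * ((2 * (4 * t * k + 1)) ^ (D ^ 2).primeFactors.card *
          powPart k (D ^ 2)) := by
          rw [div_pow]
          field_simp
      _ ≤ (2 ^ (2 * t) * ((M : ℝ) ^ (2 * t) + (n : ℝ) ^ (t + 1))) *
          (C₁ * (n : ℝ) ^ ε * powPart k (D ^ 2)) := by
          gcongr
          refine hMD.trans ?_
          gcongr
          exact hDt.trans hnt
      _ = _ := by ring
  have err : (D : ℝ) ^ 2 * squareErr k D ^ (2 * t) ≤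
      C₂ ^ (2 * t) * ((n : ℝ) ^ ε * powPart k (D ^ 2) *
        ((M : ℝ) ^ (2 * t) + (n : ℝ) ^ (t + 1))) := by
    have hE0 : 0 ≤ squareErr k D :=
      (norm_nonneg _).trans (norm_weylSum_square_sub_le (by omega : 2 ≤ k) D 0 0 hD)
    have hpow : ((D : ℝ) ^ (ε / (2 * t))) ^ (2 * t) = (D : ℝ) ^ ε := by
      rw [← Real.rpow_natCast, ← Real.rpow_mul hD0.le]
      congr 1
      push_cast
      field_simp
    calc (D : ℝ) ^ 2 * squareErr k D ^ (2 * t)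
        ≤ (D : ℝ) ^ 2 * (C₂ * D * (D : ℝ) ^ (ε / (2 * t))) ^ (2 * t) := by
          gcongr
          exact h₂ D hD
      _ = C₂ ^ (2 * t) * ((D : ℝ) ^ ε * ((D : ℝ) ^ 2 * (D : ℝ) ^ (2 * t))) := by
          rw [mul_pow, mul_pow, hpow]; ring
      _ ≤ C₂ ^ (2 * t) * ((n : ℝ) ^ ε * (n * (n : ℝ) ^ t)) := by gcongr
      _ ≤ _ := by
          refine mul_le_mul_of_nonneg_left ?_ (by positivity)
          rw [mul_assoc]
          refine mul_le_mul_of_nonneg_left ?_ (by positivity)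
          rw [← pow_succ']
          have h0 : (0 : ℝ) ≤ (M : ℝ) ^ (2 * t) := by positivity
          have h1 : (0 : ℝ) ≤ (n : ℝ) ^ (t + 1) := by positivity
          nlinarith
  refine (congCount_square_le (by omega : 2 ≤ k) t D M hD).trans ?_
  refine (mul_le_mul_of_nonneg_left (add_le_add main err) (by positivity)).trans (le_of_eq ?_)
  ring

/-- The number of solutions in `S` of the congruence `∑ x_i ^ k ≡ ∑ y_i ^ k (mod q)` for which the
two sides are different integers. -/
def congCountNe (k t q : ℕ) (S : Finset ℤ) : ℕ :=
  ((tuples t S).filter fun x => powForm k x ≠ 0 ∧ (q : ℤ) ∣ powForm k x).card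

theorem congCount_eq_add (k t q : ℕ) (S : Finset ℤ) :
    congCount k t q S =
      ((tuples t S).filter fun x => powForm k x = 0).card + congCountNe k t q S := by
  rw [congCount, ← Finset.card_filter_add_card_filter_not (fun x => powForm k x = 0),
    Finset.filter_filter, Finset.filter_filter, congCountNe]
  congr 2
  · refine Finset.filter_congr fun x _ => ⟨fun h => h.2, fun h => ⟨by simp [h], h⟩⟩
  · exact Finset.filter_congr fun x _ => and_comm

theorem sum_congCountNe_le (k t D n : ℕ) (S : Finset ℤ) (T : ℝ)
    (hT : ∀ x ∈ tuples t S, ((powForm k x).natAbs.divisors.card : ℝ) ≤ T) :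
    ∑ r ∈ Finset.Icc 1 n, (congCountNe k t (r * D ^ 2) S : ℝ) ≤
      T * congCount k t (D ^ 2) S := by
  have h1 : ∀ r : ℕ, (congCountNe k t (r * D ^ 2) S : ℝ) = ∑ x ∈ tuples t S,
      if powForm k x ≠ 0 ∧ ((r * D ^ 2 : ℕ) : ℤ) ∣ powForm k x then 1 else 0 := by
    intro r
    rw [congCountNe, Finset.card_filter]
    push_cast
    rfl
  simp only [h1]
  rw [Finset.sum_comm, congCount, Finset.card_filter]
  push_cast
  rw [Finset.mul_sum]
  refine Finset.sum_le_sum fun x hx => ?_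
  have hT0 : 0 ≤ T := le_trans (by positivity) (hT x hx)
  by_cases hD : (D : ℤ) ^ 2 ∣ powForm k x
  · rw [if_pos hD, mul_one]
    refine le_trans ?_ (hT x hx)
    rw [Finset.sum_boole]
    refine Nat.cast_le.2 (Finset.card_le_card fun r hr => ?_)
    rw [Finset.mem_filter] at hr
    rw [Nat.mem_divisors]
    refine ⟨?_, by simpa using hr.2.1⟩
    rw [← Int.natCast_dvd]
    exact dvd_trans (Dvd.intro _ rfl) hr.2.2
  · rw [if_neg hD, mul_zero]
    refine le_of_eq (Finset.sum_eq_zero fun r _ => if_neg fun h => hD ?_)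
    exact dvd_trans (Dvd.intro_left _ rfl) h.2

/-- Every modulus is the product of a squarefree number and a square. -/
theorem sum_le_sum_squarefree_mul_sq (f : ℕ → ℝ) (hf : ∀ q, 0 ≤ f q) (n : ℕ) :
    ∑ q ∈ Finset.Icc 1 n, f q ≤ ∑ D ∈ (Finset.Icc 1 n).filter (fun D => D ^ 2 ≤ n),
      ∑ r ∈ (Finset.Icc 1 n).filter (fun r => Squarefree r ∧ r * D ^ 2 ≤ n), f (r * D ^ 2) := by
  classical
  have hex : ∀ q : ℕ, ∃ c : ℕ × ℕ, 1 ≤ q →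
      0 < c.2 ∧ 0 < c.1 ∧ c.2 * c.1 ^ 2 = q ∧ Squarefree c.2 := by
    intro q
    rcases Nat.eq_zero_or_pos q with rfl | hq
    · exact ⟨(0, 0), by omega⟩
    · obtain ⟨a, b, ha, hb, h, hs⟩ := Nat.sq_mul_squarefree_of_pos hq
      exact ⟨(b, a), fun _ => ⟨ha, hb, by rw [mul_comm]; exact h, hs⟩⟩
  choose g hg using hex
  rw [Finset.sum_sigma']
  have hinj : Set.InjOn (fun q => (⟨(g q).1, (g q).2⟩ : Σ _ : ℕ, ℕ)) (Finset.Icc 1 n : Finset ℕ) := by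
    intro q hq q' hq' h
    rw [Finset.mem_coe, Finset.mem_Icc] at hq hq'
    simp only [Sigma.mk.injEq, heq_eq_eq] at h
    rw [← (hg q hq.1).2.2.1, ← (hg q' hq'.1).2.2.1, h.1, h.2]
  calc ∑ q ∈ Finset.Icc 1 n, f q
      = ∑ q ∈ Finset.Icc 1 n, (fun c : Σ _ : ℕ, ℕ => f (c.2 * c.1 ^ 2)) ⟨(g q).1, (g q).2⟩ := by
        refine Finset.sum_congr rfl fun q hq => ?_
        rw [Finset.mem_Icc] at hq
        simp only [(hg q hq.1).2.2.1]
    _ = ∑ c ∈ (Finset.Icc 1 n).image (fun q => (⟨(g q).1, (g q).2⟩ : Σ _ : ℕ, ℕ)),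
          f (c.2 * c.1 ^ 2) :=
        (Finset.sum_image (f := fun c : Σ _ : ℕ, ℕ => f (c.2 * c.1 ^ 2)) hinj).symm
    _ ≤ _ := by
        refine Finset.sum_le_sum_of_subset_of_nonneg ?_ fun _ _ _ => hf _
        intro c hc
        obtain ⟨q, hq, rfl⟩ := Finset.mem_image.1 hc
        rw [Finset.mem_Icc] at hq
        obtain ⟨h1, h2, h3, h4⟩ := hg q hq.1
        simp only [Finset.mem_sigma, Finset.mem_filter, Finset.mem_Icc]
        have hD : (g q).1 ^ 2 ≤ n := (Nat.le_mul_of_pos_left _ h1).trans (h3.le.trans hq.2)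
        have hr : (g q).2 ≤ n :=
          (Nat.le_mul_of_pos_right _ (by positivity)).trans (h3.le.trans hq.2)
        exact ⟨⟨⟨h2, (Nat.le_self_pow two_ne_zero _).trans hD⟩, hD⟩, ⟨h1, hr⟩, h4,
          h3.le.trans hq.2⟩

theorem sum_kappa_sq_mul_congCountNe_le {k t : ℕ} (hk : 3 ≤ k) (ht : k / 2 ≤ t) {ε : ℝ}
    (hε : 0 < ε) :
    ∃ C : ℝ, 1 ≤ C ∧ ∀ n M : ℕ, 1 ≤ M → M ≤ n →
      ∑ q ∈ Finset.Icc 1 n, kappa k q ^ 2 * (q * congCountNe k t q (box M)) ≤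
        C * (n : ℝ) ^ ε * ((M : ℝ) ^ (2 * t) + (n : ℝ) ^ (t + 1)) := by
  have hη : 0 < ε / 4 := by positivity
  have hk1 : (1 : ℝ) ≤ k := by exact_mod_cast (by omega : 1 ≤ k)
  obtain ⟨C₁, hC₁, h₁⟩ := pow_card_primeFactors_le_rpow ((k : ℝ) ^ 2) (one_le_pow₀ hk1) hη
  obtain ⟨C₂, hC₂, h₂⟩ := card_divisors_natAbs_le k t hη
  obtain ⟨C₃, hC₃, h₃⟩ := congCount_square_le_rpow hk ht hη
  obtain ⟨C₄, hC₄, h₄⟩ := sum_invRad_le hη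
  refine ⟨C₁ * C₂ * C₃ * C₄, ?_, fun n M hM hMn => ?_⟩
  · exact one_le_mul_of_one_le_of_one_le (one_le_mul_of_one_le_of_one_le
      (one_le_mul_of_one_le_of_one_le hC₁ hC₂) hC₃) hC₄
  have hn1 : (1 : ℝ) ≤ n := by exact_mod_cast hM.trans hMn
  have hMn' : (M : ℝ) ≤ n := by exact_mod_cast hMn
  set x : ℝ := (n : ℝ) ^ (ε / 4) with hx
  have hx1 : 1 ≤ x := Real.one_le_rpow hn1 hη.le
  have hx4 : (n : ℝ) ^ ε = x ^ 4 := by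
    rw [hx, ← Real.rpow_natCast, ← Real.rpow_mul (by positivity)]
    congr 1
    push_cast
    ring
  set Y : ℝ := (M : ℝ) ^ (2 * t) + (n : ℝ) ^ (t + 1) with hY
  have hY0 : 0 ≤ Y := by positivity
  have hT : ∀ y ∈ tuples t (box M), ((powForm k y).natAbs.divisors.card : ℝ) ≤ C₂ * x := by
    intro y hy
    refine (h₂ M hM _ (abs_powForm_le hy)).trans ?_
    rw [hx]
    gcongr
  refine (sum_le_sum_squarefree_mul_sq _ (fun q => by positivity) n).trans ?_
  have inner : ∀ D ∈ (Finset.Icc 1 n).filter (fun D => D ^ 2 ≤ n),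
      ∑ r ∈ (Finset.Icc 1 n).filter (fun r => Squarefree r ∧ r * D ^ 2 ≤ n),
        kappa k (r * D ^ 2) ^ 2 * (((r * D ^ 2 : ℕ) : ℝ) * congCountNe k t (r * D ^ 2) (box M)) ≤
      C₁ * C₂ * C₃ * x ^ 3 * Y * invRad D := by
    intro D hD
    rw [Finset.mem_filter, Finset.mem_Icc] at hD
    obtain ⟨⟨hD1, -⟩, hDn⟩ := hD
    set P := powPart k (D ^ 2) with hP
    have hP1 : 1 ≤ P := one_le_powPart k _
    have hP0 : 0 < P := by linarith
    have hR := invRad_nonneg D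
    have term : ∀ r ∈ (Finset.Icc 1 n).filter (fun r => Squarefree r ∧ r * D ^ 2 ≤ n),
        kappa k (r * D ^ 2) ^ 2 *
          (((r * D ^ 2 : ℕ) : ℝ) * congCountNe k t (r * D ^ 2) (box M)) ≤
        C₁ * x * invRad D / P * (D : ℝ) ^ 2 * congCountNe k t (r * D ^ 2) (box M) := by
      intro r hr
      rw [Finset.mem_filter, Finset.mem_Icc] at hr
      obtain ⟨⟨hr1, -⟩, hs, hrn⟩ := hr
      have hκ := kappa_sq_mul_squarefree_le hk hs (by omega : D ≠ 0)
      have hω : ((k : ℝ) ^ 2) ^ (r * D ^ 2).primeFactors.card ≤ C₁ * x := by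
        refine (h₁ (r * D ^ 2) (by positivity)).trans ?_
        have : ((r * D ^ 2 : ℕ) : ℝ) ≤ n := by exact_mod_cast hrn
        rw [hx]
        gcongr
      have hκ' : kappa k (r * D ^ 2) ^ 2 * r ≤ C₁ * x * invRad D / P := by
        rw [le_div_iff₀ hP0]
        exact hκ.trans (mul_le_mul_of_nonneg_right hω hR)
      calc _ = kappa k (r * D ^ 2) ^ 2 * r * ((D : ℝ) ^ 2 *
              congCountNe k t (r * D ^ 2) (box M)) := by push_cast; ring
        _ ≤ C₁ * x * invRad D / P * ((D : ℝ) ^ 2 *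
              congCountNe k t (r * D ^ 2) (box M)) := by gcongr
        _ = _ := by ring
    refine (Finset.sum_le_sum term).trans ?_
    rw [← Finset.mul_sum]
    have hsum : ∑ r ∈ (Finset.Icc 1 n).filter (fun r => Squarefree r ∧ r * D ^ 2 ≤ n),
        (congCountNe k t (r * D ^ 2) (box M) : ℝ) ≤
        C₂ * x * congCount k t (D ^ 2) (box M) :=
      (Finset.sum_le_sum_of_subset_of_nonneg (Finset.filter_subset _ _)
        fun _ _ _ => by positivity).trans (sum_congCountNe_le k t D n (box M) _ hT)
    have hsq := h₃ D M n hD1 hDn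
    calc _ ≤ C₁ * x * invRad D / P * (D : ℝ) ^ 2 *
          (C₂ * x * congCount k t (D ^ 2) (box M)) := by gcongr
      _ = C₁ * x * invRad D / P * (C₂ * x) *
          ((D : ℝ) ^ 2 * congCount k t (D ^ 2) (box M)) := by ring
      _ ≤ C₁ * x * invRad D / P * (C₂ * x) * (C₃ * x * P * Y) := by gcongr
      _ = _ := by field_simp
  refine (Finset.sum_le_sum inner).trans ?_
  rw [← Finset.mul_sum]
  have hrad : ∑ D ∈ (Finset.Icc 1 n).filter (fun D => D ^ 2 ≤ n), invRad D ≤ C₄ * x :=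
    (Finset.sum_le_sum_of_subset_of_nonneg (Finset.filter_subset _ _)
      fun _ _ _ => invRad_nonneg _).trans (h₄ n)
  calc _ ≤ C₁ * C₂ * C₃ * x ^ 3 * Y * (C₄ * x) := by gcongr
    _ = _ := by rw [hx4]; ring

theorem sum_kappa_sq_le {k : ℕ} (hk : 2 ≤ k) {ε : ℝ} (hε : 0 < ε) :
    ∃ C : ℝ, 1 ≤ C ∧ ∀ n : ℕ, ∑ q ∈ Finset.Icc 1 n, kappa k q ^ 2 ≤ C * (n : ℝ) ^ ε := by
  have hη : 0 < ε / 2 := by positivity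
  have hk1 : (1 : ℝ) ≤ k := by exact_mod_cast (by omega : 1 ≤ k)
  obtain ⟨C₁, hC₁, h₁⟩ := pow_card_primeFactors_le_rpow ((k : ℝ) ^ 2) (one_le_pow₀ hk1) hη
  obtain ⟨C₂, hC₂, h₂⟩ := sum_invRad_le hη
  refine ⟨C₁ * C₂, one_le_mul_of_one_le_of_one_le hC₁ hC₂, fun n => ?_⟩
  have hsq : (n : ℝ) ^ ε = (n : ℝ) ^ (ε / 2) * (n : ℝ) ^ (ε / 2) := by
    rw [← pow_two, ← Real.rpow_natCast, ← Real.rpow_mul (by positivity)]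
    congr 1
    push_cast
    ring
  calc ∑ q ∈ Finset.Icc 1 n, kappa k q ^ 2
      ≤ ∑ q ∈ Finset.Icc 1 n, C₁ * (n : ℝ) ^ (ε / 2) * invRad q := by
        refine Finset.sum_le_sum fun q hq => ?_
        rw [Finset.mem_Icc] at hq
        refine (kappa_sq_le hk q (by omega)).trans
          (mul_le_mul_of_nonneg_right ?_ (invRad_nonneg q))
        refine (h₁ q (by omega)).trans ?_
        have : (q : ℝ) ≤ n := by exact_mod_cast hq.2
        gcongr
    _ = C₁ * (n : ℝ) ^ (ε / 2) * ∑ q ∈ Finset.Icc 1 n, invRad q := by rw [Finset.mul_sum]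
    _ ≤ C₁ * (n : ℝ) ^ (ε / 2) * (C₂ * (n : ℝ) ^ (ε / 2)) := by
        gcongr
        exact h₂ n
    _ = _ := by rw [hsq]; ring

theorem mul_card_zeros_le {k t : ℕ} (hk : 3 ≤ k) (ht : k / 2 ≤ t) {ε : ℝ} (hε : 0 < ε) :
    ∃ C : ℝ, 1 ≤ C ∧ ∀ n M : ℕ, 1 ≤ M → M ≤ n →
      (n : ℝ) * ((tuples t (box M)).filter fun x => powForm k x = 0).card ≤
        C * (n : ℝ) ^ ε * ((M : ℝ) ^ (2 * t) + (n : ℝ) ^ (t + 1)) := by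
  have ht1 : 1 ≤ t := by omega
  rcases Nat.lt_or_ge t 2 with h2 | h2
  · obtain rfl : t = 1 := by omega
    refine ⟨1, le_rfl, fun n M hM hMn => ?_⟩
    have hn1 : (1 : ℝ) ≤ n := by exact_mod_cast hM.trans hMn
    have hMn' : (M : ℝ) ≤ n := by exact_mod_cast hMn
    have hz : ((((tuples 1 (box M)).filter fun x => powForm k x = 0).card : ℕ) : ℝ) ≤ M := by
      exact_mod_cast card_zeros_one_le (by omega : k ≠ 0) M
    have hx1 : 1 ≤ (n : ℝ) ^ ε := Real.one_le_rpow hn1 hε.le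
    calc _ ≤ (n : ℝ) * n := mul_le_mul_of_nonneg_left (hz.trans hMn') (by positivity)
      _ = (n : ℝ) ^ (1 + 1) := (pow_two _).symm
      _ ≤ (M : ℝ) ^ (2 * 1) + (n : ℝ) ^ (1 + 1) := le_add_of_nonneg_left (by positivity)
      _ ≤ _ := by
          rw [one_mul]
          exact le_mul_of_one_le_left (by positivity) hx1
  · obtain ⟨C, hC, hz⟩ := card_zeros_le (by omega : 2 ≤ k) h2 hε
    refine ⟨C, hC, fun n M hM hMn => ?_⟩
    have hn1 : (1 : ℝ) ≤ n := by exact_mod_cast hM.trans hMn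
    have hM1 : (1 : ℝ) ≤ M := by exact_mod_cast hM
    have hMn' : (M : ℝ) ≤ n := by exact_mod_cast hMn
    have hcmp : (n : ℝ) * (M : ℝ) ^ (2 * t - 2) ≤ (M : ℝ) ^ (2 * t) + (n : ℝ) ^ (t + 1) := by
      rcases le_total (n : ℝ) ((M : ℝ) ^ 2) with h | h
      · have : (n : ℝ) * (M : ℝ) ^ (2 * t - 2) ≤ (M : ℝ) ^ 2 * (M : ℝ) ^ (2 * t - 2) := by gcongr
        rw [← pow_add, show 2 + (2 * t - 2) = 2 * t by omega] at this
        have h0 : (0 : ℝ) ≤ (n : ℝ) ^ (t + 1) := by positivity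
        linarith
      · have h1 : (M : ℝ) ^ (2 * t - 2) ≤ (n : ℝ) ^ t := by
          rw [show 2 * t - 2 = 2 * (t - 1) by omega, pow_mul]
          exact (pow_le_pow_left₀ (by positivity) h _).trans (pow_le_pow_right₀ hn1 (by omega))
        have h0 : (0 : ℝ) ≤ (M : ℝ) ^ (2 * t) := by positivity
        rw [pow_succ']
        nlinarith
    calc _ ≤ (n : ℝ) * (C * (M : ℝ) ^ (2 * t - 2) * (M : ℝ) ^ ε) := by gcongr; exact hz M hM
      _ ≤ (n : ℝ) * (C * (M : ℝ) ^ (2 * t - 2) * (n : ℝ) ^ ε) := by gcongr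
      _ = C * (n : ℝ) ^ ε * ((n : ℝ) * (M : ℝ) ^ (2 * t - 2)) := by ring
      _ ≤ _ := by gcongr

/-- The arithmetic core: the mean of the congruence counts against `κ(q) ^ 2 q`. -/
theorem sum_kappa_sq_mul_congCount_le {k t : ℕ} (hk : 3 ≤ k) (ht : k / 2 ≤ t) {ε : ℝ}
    (hε : 0 < ε) :
    ∃ C : ℝ, 1 ≤ C ∧ ∀ n M : ℕ, 1 ≤ n → 1 ≤ M →
      ∑ q ∈ Finset.Icc 1 n, kappa k q ^ 2 * (q * congCount k t q (box M)) ≤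
        C * (n : ℝ) ^ ε * ((M : ℝ) ^ (2 * t) + (n : ℝ) ^ (t + 1)) := by
  have hη : 0 < ε / 2 := by positivity
  have hk1 : (1 : ℝ) ≤ k := by exact_mod_cast (by omega : 1 ≤ k)
  have hB0 : (0 : ℝ) ≤ 4 * t * k := by positivity
  obtain ⟨C₁, hC₁, h₁⟩ := pow_card_primeFactors_le_rpow ((k : ℝ) ^ 2 * (2 * (4 * t * k + 1)))
    (one_le_mul_of_one_le_of_one_le (one_le_pow₀ hk1) (by linarith)) hη
  obtain ⟨C₂, hC₂, h₂⟩ := sum_invRad_le hη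
  obtain ⟨C₃, hC₃, h₃⟩ := sum_kappa_sq_mul_congCountNe_le hk ht hε
  obtain ⟨C₄, hC₄, h₄⟩ := sum_kappa_sq_le (by omega : 2 ≤ k) hη
  obtain ⟨C₅, hC₅, h₅⟩ := mul_card_zeros_le hk ht hη
  refine ⟨2 ^ (2 * t) * C₁ * C₂ + (C₃ + C₄ * C₅), ?_, fun n M hn hM => ?_⟩
  · have : (0 : ℝ) ≤ 2 ^ (2 * t) * C₁ * C₂ := by positivity
    have : (0 : ℝ) ≤ C₄ * C₅ := by positivity
    linarith
  have hn1 : (1 : ℝ) ≤ n := by exact_mod_cast hn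
  set x : ℝ := (n : ℝ) ^ (ε / 2) with hx
  have hx1 : 1 ≤ x := Real.one_le_rpow hn1 hη.le
  have hx2 : (n : ℝ) ^ ε = x ^ 2 := by
    rw [hx, ← Real.rpow_natCast, ← Real.rpow_mul (by positivity)]
    congr 1
    push_cast
    ring
  rw [hx2]
  set Y : ℝ := (M : ℝ) ^ (2 * t) + (n : ℝ) ^ (t + 1) with hY
  have hY0 : 0 ≤ Y := by positivity
  rcases le_total n M with hnM | hMn
  · -- each residue class modulo `q` meets the box in at most `2 M / q` points
    have term : ∀ q ∈ Finset.Icc 1 n, kappa k q ^ 2 * (q * congCount k t q (box M)) ≤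
        2 ^ (2 * t) * C₁ * x * Y * invRad q := by
      intro q hq
      rw [Finset.mem_Icc] at hq
      have hq0 : q ≠ 0 := by omega
      set L := M / q + 1 with hL
      have hML : M ≤ q * L := (Nat.lt_mul_div_succ M (by omega)).le
      have hqL : ((q * L : ℕ) : ℝ) ≤ 2 * M := by
        have : q * L ≤ 2 * M := by
          rw [hL, mul_add, mul_one, two_mul]
          exact Nat.add_le_add (Nat.mul_div_le M q) (hq.2.trans hnM)
        exact_mod_cast this
      have hmono : (congCount k t q (box M) : ℝ) ≤ L ^ (2 * t) * congCount k t q (box q) := by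
        have := congCount_mono (k := k) (t := t) (q := q) (box_mono hML)
        rw [congCount_box_mul k t q L hq0] at this
        exact_mod_cast this
      have hbox := congCount_box_le hk ht q hq0
      have hκ := kappa_sq_mul_powPart_le (by omega : 2 ≤ k) q hq0
      have hω : ((k : ℝ) ^ 2 * (2 * (4 * t * k + 1))) ^ q.primeFactors.card ≤ C₁ * x := by
        refine (h₁ q hq0).trans ?_
        have : (q : ℝ) ≤ n := by exact_mod_cast hq.2
        rw [hx]
        gcongr
      have hR := invRad_nonneg q
      have hP : 0 ≤ powPart k q := zero_le_one.trans (one_le_powPart k q)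
      set w := q.primeFactors.card
      calc kappa k q ^ 2 * (q * congCount k t q (box M))
          ≤ kappa k q ^ 2 * (q * (L ^ (2 * t) * congCount k t q (box q))) := by gcongr
        _ = kappa k q ^ 2 * L ^ (2 * t) * (q * congCount k t q (box q)) := by ring
        _ ≤ kappa k q ^ 2 * L ^ (2 * t) *
            ((2 * (4 * t * k + 1)) ^ w * powPart k q * (q : ℝ) ^ (2 * t)) := by gcongr
        _ = ((q * L : ℕ) : ℝ) ^ (2 * t) * ((2 * (4 * t * k + 1)) ^ w *
            (kappa k q ^ 2 * powPart k q)) := by push_cast; ring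
        _ ≤ (2 * M) ^ (2 * t) * ((2 * (4 * t * k + 1)) ^ w *
            (((k : ℝ) ^ 2) ^ w * invRad q)) := by gcongr
        _ = 2 ^ (2 * t) * (((k : ℝ) ^ 2 * (2 * (4 * t * k + 1))) ^ w * (M : ℝ) ^ (2 * t) *
            invRad q) := by rw [mul_pow ((k : ℝ) ^ 2), mul_pow (2 : ℝ) (M : ℝ)]; ring
        _ ≤ 2 ^ (2 * t) * (C₁ * x * Y * invRad q) := by
            gcongr
            rw [hY]
            exact le_add_of_nonneg_right (by positivity)
        _ = _ := by ring
    refine (Finset.sum_le_sum term).trans ?_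
    rw [← Finset.mul_sum]
    calc _ ≤ 2 ^ (2 * t) * C₁ * x * Y * (C₂ * x) := by gcongr; exact h₂ n
      _ = 2 ^ (2 * t) * C₁ * C₂ * x ^ 2 * Y := by ring
      _ ≤ _ := by
          gcongr
          exact le_add_of_nonneg_right (by positivity)
  · have hsplit : ∑ q ∈ Finset.Icc 1 n, kappa k q ^ 2 * (q * congCount k t q (box M)) ≤
        (∑ q ∈ Finset.Icc 1 n, kappa k q ^ 2) *
          ((n : ℝ) * ((tuples t (box M)).filter fun x => powForm k x = 0).card) +
        ∑ q ∈ Finset.Icc 1 n, kappa k q ^ 2 * (q * congCountNe k t q (box M)) := by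
      rw [Finset.sum_mul, ← Finset.sum_add_distrib]
      refine Finset.sum_le_sum fun q hq => ?_
      rw [Finset.mem_Icc] at hq
      have : (q : ℝ) ≤ n := by exact_mod_cast hq.2
      rw [congCount_eq_add, Nat.cast_add, mul_add, mul_add]
      gcongr
    refine hsplit.trans ?_
    have h4 := mul_le_mul (h₄ n) (h₅ n M hM hMn) (by positivity) (by positivity)
    have h3 := h₃ n M hM hMn
    rw [hx2] at h3
    calc _ ≤ C₄ * x * (C₅ * x * Y) + C₃ * x ^ 2 * Y := add_le_add h4 h3
      _ = (C₃ + C₄ * C₅) * x ^ 2 * Y := by ring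
      _ ≤ _ := by
          rw [mul_assoc, mul_assoc (_ + _)]
          exact mul_le_mul_of_nonneg_right (le_add_of_nonneg_left (by positivity)) (by positivity)

/-! ### The integral over the major arcs -/

open MeasureTheory

theorem integrable_decay {δ : ℝ} (hδ : 1 < δ) {A : ℝ} (hA : 0 < A) :
    Integrable fun β : ℝ => (1 + A * |β|) ^ (-δ) := by
  have h := (integrable_one_add_norm (E := ℝ) (μ := volume) (r := δ) (by simpa using hδ))
  have h2 := h.comp_mul_left' hA.ne'
  refine h2.congr (Filter.Eventually.of_forall fun β => ?_)
  simp [abs_of_pos hA]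

theorem integral_decay (δ : ℝ) {A : ℝ} (hA : 0 < A) :
    ∫ β : ℝ, (1 + A * |β|) ^ (-δ) = A⁻¹ * ∫ β : ℝ, (1 + |β|) ^ (-δ) := by
  have := Measure.integral_comp_mul_left (fun β : ℝ => (1 + |β|) ^ (-δ)) A
  simp only [abs_mul, abs_of_pos hA, abs_inv, smul_eq_mul] at this
  exact this

theorem norm_weylSum_le (k : ℕ) (Z : Finset ℤ) (α : ℝ) : ‖weylSum k Z α‖ ≤ Z.card := by
  rw [weylSum_eq]
  refine (norm_sum_le _ _).trans ?_
  simp [norm_e]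

theorem integrable_decay_mul_weylSum (k t : ℕ) {δ : ℝ} (hδ : 1 < δ) {A : ℝ} (hA : 0 < A)
    (Z : Finset ℤ) (c : ℝ) :
    Integrable fun β : ℝ => (1 + A * |β|) ^ (-δ) * ‖weylSum k Z (β + c)‖ ^ (2 * t) := by
  refine (integrable_decay hδ hA).mul_bdd (c := (Z.card : ℝ) ^ (2 * t)) ?_ ?_
  · refine Continuous.aestronglyMeasurable ?_
    exact ((continuous_weylSum k Z).comp (by fun_prop)).norm.pow _
  · refine Filter.Eventually.of_forall fun β => ?_
    rw [norm_pow, norm_norm]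
    exact pow_le_pow_left₀ (norm_nonneg _) (norm_weylSum_le k Z _) _

theorem measurableSet_arc (k : ℕ) (X Y : ℝ) (q a : ℕ) : MeasurableSet (arc k X Y q a) := by
  have h : IsClosed {α : ℝ | |(q : ℝ) * α - a| ≤ Y / X ^ k} :=
    isClosed_le (by fun_prop) continuous_const
  exact measurableSet_Ico.inter h.measurableSet

theorem sum_arcIndex_le {Q : ℝ} (hQ : 1 ≤ Q) (G : ℕ → ℕ → ℝ) (hG : ∀ q a, 0 ≤ G q a) :
    ∑ c ∈ arcIndex Q, G c.1 c.2 ≤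
      ∑ q ∈ Finset.Icc 1 ⌊Q⌋₊, ∑ a ∈ Finset.range (q + 1), G q a := by
  classical
  have hQ0 : 0 ≤ Q := by linarith
  have hmem : ∀ c ∈ arcIndex Q, c.1 ∈ Finset.Icc 1 ⌊Q⌋₊ ∧ c.2 ∈ Finset.range (c.1 + 1) := by
    rintro ⟨q, a⟩ hc
    obtain ⟨h1, h2, h3⟩ := (mem_arcIndex hQ0).1 hc
    rw [Finset.mem_Icc, Finset.mem_range]
    refine ⟨⟨?_, Nat.le_floor h2⟩, Nat.lt_succ_of_le h1⟩
    rcases Nat.eq_zero_or_pos q with rfl | h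
    · obtain rfl : a = 0 := Nat.le_zero.1 h1
      simp at h3
    · exact h
  rw [Finset.sum_sigma']
  have hinj : Set.InjOn (fun c : ℕ × ℕ => (⟨c.1, c.2⟩ : Σ _ : ℕ, ℕ)) (arcIndex Q : Set (ℕ × ℕ)) := by
    rintro ⟨q, a⟩ - ⟨q', a'⟩ - h
    simpa using h
  have := Finset.sum_image (f := fun c : Σ _ : ℕ, ℕ => G c.1 c.2) hinj
  refine this.symm.le.trans (Finset.sum_le_sum_of_subset_of_nonneg ?_ fun _ _ _ => hG _ _)
  intro c hc
  obtain ⟨d, hd, rfl⟩ := Finset.mem_image.1 hc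
  rw [Finset.mem_sigma]
  exact hmem d hd

/-- The integrand as a sum over the arcs, in which every summand extends to an integrable function
on the whole real line. -/
theorem upsilon_mul_eq (k t : ℕ) (δ Q X Y : ℝ) (Z : Finset ℤ) (α : ℝ) :
    upsilon k δ Q X Y α * ‖weylSum k Z α‖ ^ (2 * t) =
      ∑ c ∈ arcIndex Q, (arc k X Y c.1 c.2).indicator (fun β => kappa k c.1 ^ 2 *
        ((1 + X ^ k * |β - (c.2 : ℝ) / c.1|) ^ (-δ) * ‖weylSum k Z β‖ ^ (2 * t))) α := by
  rw [upsilon, Finset.sum_mul]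
  refine Finset.sum_congr rfl fun c _ => ?_
  by_cases h : α ∈ arc k X Y c.1 c.2
  · rw [Set.indicator_of_mem h, Set.indicator_of_mem h, mul_assoc]
  · rw [Set.indicator_of_notMem h, Set.indicator_of_notMem h, zero_mul]

theorem integrable_upsilon_term (k t q a : ℕ) {δ X : ℝ} (hδ : 1 < δ) (hX : 1 ≤ X)
    (Z : Finset ℤ) : Integrable fun β : ℝ => kappa k q ^ 2 *
      ((1 + X ^ k * |β - (a : ℝ) / q|) ^ (-δ) * ‖weylSum k Z β‖ ^ (2 * t)) := by
  have hA : 0 < X ^ k := by positivity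
  have h := (integrable_decay_mul_weylSum k t hδ hA Z ((a : ℝ) / q)).comp_sub_right ((a : ℝ) / q)
  simp only [sub_add_cancel] at h
  exact h.const_mul _

theorem integrable_upsilon_mul (k t : ℕ) {δ X : ℝ} (hδ : 1 < δ) (hX : 1 ≤ X) (Q Y : ℝ)
    (Z : Finset ℤ) :
    Integrable fun α : ℝ => upsilon k δ Q X Y α * ‖weylSum k Z α‖ ^ (2 * t) := by
  simp only [upsilon_mul_eq]
  exact integrable_finsetSum _ fun c _ =>
    (integrable_upsilon_term k t c.1 c.2 hδ hX Z).indicator (measurableSet_arc k X Y c.1 c.2)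

/-- The integral is bounded by a mean of congruence counts. All terms being non-negative, each arc
may be completed to the whole real line, so that for fixed `β` the points `a / q + β` run over all
numerators `a`. -/
theorem integral_upsilon_mul_le (k t : ℕ) {δ Q X : ℝ} (hδ : 1 < δ) (hQ : 1 ≤ Q) (hX : 1 ≤ X)
    (Y : ℝ) (Z : Finset ℤ) :
    ∫ α in majorArcs k Q X Y, upsilon k δ Q X Y α * ‖weylSum k Z α‖ ^ (2 * t) ≤
      2 * (∫ β : ℝ, (1 + |β|) ^ (-δ)) * (X ^ k)⁻¹ *
        ∑ q ∈ Finset.Icc 1 ⌊Q⌋₊, kappa k q ^ 2 * (q * congCount k t q Z) := by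
  have hX0 : 0 < X := by linarith
  have hA : 0 < X ^ k := by positivity
  set F : ℕ → ℕ → ℝ → ℝ := fun q a β => kappa k q ^ 2 *
      ((1 + X ^ k * |β - (a : ℝ) / q|) ^ (-δ) * ‖weylSum k Z β‖ ^ (2 * t)) with hF
  have hF0 : ∀ q a β, 0 ≤ F q a β := fun q a β => by simp only [hF]; positivity
  have hFi : ∀ q a, Integrable (F q a) := fun q a => integrable_upsilon_term k t q a hδ hX Z
  have hshift : ∀ q a : ℕ, ∫ β, F q a β = kappa k q ^ 2 *
      ∫ β : ℝ, (1 + X ^ k * |β|) ^ (-δ) * ‖weylSum k Z (β + a / q)‖ ^ (2 * t) := by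
    intro q a
    simp only [hF]
    rw [integral_const_mul]
    have := integral_sub_right_eq_self (μ := volume) (fun β : ℝ =>
      (1 + X ^ k * |β|) ^ (-δ) * ‖weylSum k Z (β + a / q)‖ ^ (2 * t)) ((a : ℝ) / q)
    simp only [sub_add_cancel] at this
    rw [this]
  have step1 : ∫ α in majorArcs k Q X Y, upsilon k δ Q X Y α * ‖weylSum k Z α‖ ^ (2 * t) ≤
      ∑ c ∈ arcIndex Q, ∫ β, F c.1 c.2 β := by
    have hnn : ∀ α, 0 ≤ upsilon k δ Q X Y α * ‖weylSum k Z α‖ ^ (2 * t) := by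
      intro α
      rw [upsilon_mul_eq]
      exact Finset.sum_nonneg fun c _ => Set.indicator_nonneg (fun β _ => hF0 c.1 c.2 β) α
    refine (setIntegral_le_integral (integrable_upsilon_mul k t hδ hX Q Y Z)
      (Filter.Eventually.of_forall hnn)).trans ?_
    simp only [upsilon_mul_eq]
    rw [integral_finsetSum _ fun c _ => (hFi c.1 c.2).indicator (measurableSet_arc k X Y c.1 c.2)]
    refine Finset.sum_le_sum fun c _ => ?_
    refine integral_mono ((hFi c.1 c.2).indicator (measurableSet_arc k X Y c.1 c.2))
      (hFi c.1 c.2) fun β => ?_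
    exact Set.indicator_le_self' (fun _ _ => hF0 c.1 c.2 _) β
  refine step1.trans ((sum_arcIndex_le hQ (fun q a => ∫ β, F q a β)
    fun q a => integral_nonneg (hF0 q a)).trans ?_)
  rw [Finset.mul_sum]
  refine Finset.sum_le_sum fun q hq => ?_
  have hq0 : q ≠ 0 := by have := (Finset.mem_Icc.1 hq).1; omega
  have hqr : (q : ℝ) ≠ 0 := by exact_mod_cast hq0
  simp only [hshift]
  rw [← Finset.mul_sum, ← integral_finsetSum (f := fun (a : ℕ) (β : ℝ) =>
    (1 + X ^ k * |β|) ^ (-δ) * ‖weylSum k Z (β + a / q)‖ ^ (2 * t)) _ fun a _ =>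
    integrable_decay_mul_weylSum k t hδ hA Z ((a : ℝ) / q)]
  -- the numerators `0` and `q` give the same value
  have hpt : ∀ β : ℝ, ∑ a ∈ Finset.range (q + 1), ‖weylSum k Z (β + a / q)‖ ^ (2 * t) ≤
      2 * (q * congCount k t q Z) := by
    intro β
    have h1 := sum_norm_weylSum_pow_le k t q hq0 Z β
    have h2 : ‖weylSum k Z (β + q / q)‖ ^ (2 * t) ≤
        ∑ a ∈ Finset.range q, ‖weylSum k Z (β + a / q)‖ ^ (2 * t) := by
      rw [div_self hqr, weylSum_add_one]
      have := Finset.single_le_sum (f := fun a : ℕ => ‖weylSum k Z (β + a / q)‖ ^ (2 * t))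
        (fun _ _ => by positivity) (Finset.mem_range.2 (Nat.pos_of_ne_zero hq0))
      simpa using this
    rw [Finset.sum_range_succ]
    linarith
  have hint : ∫ β : ℝ, ∑ a ∈ Finset.range (q + 1),
      (1 + X ^ k * |β|) ^ (-δ) * ‖weylSum k Z (β + a / q)‖ ^ (2 * t) ≤
      ∫ β : ℝ, (1 + X ^ k * |β|) ^ (-δ) * (2 * (q * congCount k t q Z)) := by
    refine integral_mono (integrable_finsetSum _ fun a _ =>
      integrable_decay_mul_weylSum k t hδ hA Z ((a : ℝ) / q))
      ((integrable_decay hδ hA).mul_const _) fun β => ?_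
    simp only [← Finset.mul_sum]
    exact mul_le_mul_of_nonneg_left (hpt β) (by positivity)
  rw [integral_mul_const, integral_decay δ hA] at hint
  refine (mul_le_mul_of_nonneg_left hint (by positivity)).trans (le_of_eq ?_)
  ring

end Pruning

theorem lemma4p1 (k t : ℕ) (hk : 3 ≤ k) (ht : k / 2 ≤ t) (δ : ℝ) (hδ : 1 < δ)
    (ε : ℝ) (hε : 0 < ε) :
    ∃ C : ℝ, 0 < C ∧ ∀ Q X Y : ℝ, 1 ≤ Q → 1 ≤ X → 0 < Y → Q * Y ≤ X ^ k / 4 →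
      ∀ Z : Finset ℤ, (∀ x ∈ Z, 1 ≤ x ∧ (x : ℝ) ≤ X) →
        MeasureTheory.IntegrableOn
          (fun α : ℝ => Pruning.upsilon k δ Q X Y α * ‖Pruning.weylSum k Z α‖ ^ (2 * t))
          (Pruning.majorArcs k Q X Y) ∧
        ∫ α in Pruning.majorArcs k Q X Y,
            Pruning.upsilon k δ Q X Y α * ‖Pruning.weylSum k Z α‖ ^ (2 * t) ≤
          C * (Q ^ ε * X ^ (2 * (t : ℝ) - k) + X ^ (-(k : ℝ)) * Q ^ ((t : ℝ) + 1 + ε)) := by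
  obtain ⟨C, hC, hcore⟩ := Pruning.sum_kappa_sq_mul_congCount_le hk ht hε
  set I : ℝ := ∫ β : ℝ, (1 + |β|) ^ (-δ) with hI
  have hI0 : 0 ≤ I := MeasureTheory.integral_nonneg fun β => by positivity
  refine ⟨2 * (I + 1) * (C * 2 ^ (2 * t)), by positivity, fun Q X Y hQ hX _ _ Z hZ =>
    ⟨(Pruning.integrable_upsilon_mul k t hδ hX Q Y Z).integrableOn, ?_⟩⟩
  have hQ0 : 0 < Q := by linarith
  have hX0 : 0 < X := by linarith
  refine (Pruning.integral_upsilon_mul_le k t hδ hQ hX Y Z).trans ?_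
  set n := ⌊Q⌋₊
  set M := ⌊X⌋₊ + 1 with hM
  have hn : (n : ℝ) ≤ Q := Nat.floor_le hQ0.le
  have hn1 : 1 ≤ n := Nat.le_floor (by simpa using hQ)
  have hMX : (M : ℝ) ≤ 2 * X := by
    rw [hM]
    push_cast
    linarith [Nat.floor_le hX0.le]
  have hZM : Z ⊆ Pruning.box M := by
    intro x hx
    obtain ⟨h1, h2⟩ := hZ x hx
    rw [Pruning.mem_box]
    obtain ⟨y, rfl⟩ := Int.eq_ofNat_of_zero_le (by omega : 0 ≤ x)
    have : y ≤ ⌊X⌋₊ := Nat.le_floor (by simpa using h2)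
    omega
  have hsum : ∑ q ∈ Finset.Icc 1 n, Pruning.kappa k q ^ 2 * (q * Pruning.congCount k t q Z) ≤
      C * 2 ^ (2 * t) * (Q ^ ε * (X ^ (2 * t) + Q ^ (t + 1))) := by
    calc _ ≤ ∑ q ∈ Finset.Icc 1 n,
          Pruning.kappa k q ^ 2 * (q * Pruning.congCount k t q (Pruning.box M)) := by
          gcongr
          exact Pruning.congCount_mono hZM
      _ ≤ C * (n : ℝ) ^ ε * ((M : ℝ) ^ (2 * t) + (n : ℝ) ^ (t + 1)) :=
          hcore n M hn1 (Nat.succ_pos _)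
      _ ≤ C * Q ^ ε * ((2 * X) ^ (2 * t) + 2 ^ (2 * t) * Q ^ (t + 1)) := by
          gcongr
          refine (pow_le_pow_left₀ (by positivity) hn _).trans ?_
          exact le_mul_of_one_le_left (by positivity) (one_le_pow₀ (by norm_num))
      _ = _ := by rw [mul_pow]; ring
  have e1 : X ^ (2 * (t : ℝ) - k) = (X ^ k)⁻¹ * X ^ (2 * t) := by
    rw [Real.rpow_sub hX0, Real.rpow_natCast, div_eq_inv_mul, ← Real.rpow_natCast X (2 * t)]
    push_cast
    rfl
  have e2 : X ^ (-(k : ℝ)) = (X ^ k)⁻¹ := by rw [Real.rpow_neg hX0.le, Real.rpow_natCast]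
  have e3 : Q ^ ((t : ℝ) + 1 + ε) = Q ^ (t + 1) * Q ^ ε := by
    rw [Real.rpow_add hQ0, ← Real.rpow_natCast Q (t + 1)]
    push_cast
    rfl
  rw [e1, e2, e3]
  calc _ ≤ 2 * (I + 1) * (X ^ k)⁻¹ *
        (C * 2 ^ (2 * t) * (Q ^ ε * (X ^ (2 * t) + Q ^ (t + 1)))) := by
        gcongr
        linarith
    _ = _ := by ring
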